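/- Let $F$ be a free group of finite rank $k\ge 2$ with hyperbolic boundary $\partial F$, and let $\partial^2F=\{(\xi,\zeta)\in\partial F\times\partial F:\xi\ne\zeta\}$. A geodesic current on $F$ is an $F$-invariant positive Borel measure on $\partial^2F$ that is finite on compact sets. The nonprojectivized Outer space $cv(F)$ consists of the minimal free and discrete isometric actions of $F$ on $\mathbb R$-trees. For $T\in cv(F)$ let $\partial q_T:\partial F\to\partial T$ be the canonical $F$-equivariant homeomorphism induced by an orbit map $F\to T$, and for $x\neq y$ in $T$ let $Cyl^T_{[x,y]}\subseteq\partial^2F$ be the set of all $(\xi,\zeta)$ such that the oriented bi-infinite geodesic in $T$ from $\partial q_T(\xi)$ to $\partial q_T(\zeta)$ contains the segment $[x,y]$ with agreeing orientation. A geodesic current $\mu$ is called $T$-tame if for every real $M\ge1$ there is $C\ge1$ such that, whenever $a_1,b_1,a_2,b_2\in T$ satisfy $d_T(a_1,a_2)\le M$, $d_T(b_1,b_2)\le M$, $a_1\ne b_1$ and $a_2\ne b_2$, one has \[ \tfrac1C\,\mu\bigl(Cyl^T_{[a_2,b_2]}\bigr)\le\mu\bigl(Cyl^T_{[a_1,b_1]}\bigr)\le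 C\,\mu\bigl(Cyl^T_{[a_2,b_2]}\bigr). \] Then for every geodesic current $\mu$ on $F$ and all $T,T'\in cv(F)$, the current $\mu$ is $T$-tame if and only if it is $T'$-tame. -/

import Mathlib

open Filter Topology MeasureTheory Set
open scoped NNReal ENNReal

noncomputable section

/-! ### The boundary of a free group -/

/-- The inverse of a letter of `FreeGroup (Fin k)`: `(i, true)` is the generator `i` and
`(i, false)` is its inverse. -/
def letterInv {k : ℕ} (a : Fin k × Bool) : Fin k × Bool := (a.1, !a.2)

theorem letterInv_letterInv {k : ℕ} (a : Fin k × Bool) : letterInv (letterInv a) = a := by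
  simp [letterInv]

/-- The hyperbolic boundary of the free group on `k` letters: the infinite freely reduced words. -/
@[ext]
structure FreeBoundary (k : ℕ) where
  word : ℕ → Fin k × Bool
  reduced : ∀ n, word (n + 1) ≠ letterInv (word n)

/-- The topology of pointwise convergence of letters (two words are close if they have a long
common initial segment). -/
instance (k : ℕ) : TopologicalSpace (FreeBoundary k) :=
  TopologicalSpace.induced FreeBoundary.word inferInstance

namespace FreeBoundary

variable {k : ℕ}

/-- Put a letter in front of an infinite reduced word and reduce freely. -/
def push (a : Fin k × Bool) (ξ : FreeBoundary k) : FreeBoundary k :=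
  if h : ξ.word 0 = letterInv a then
    { word := fun n => ξ.word (n + 1)
      reduced := fun n => ξ.reduced (n + 1) }
  else
    { word := fun n => Nat.casesOn n a ξ.word
      reduced := fun n => by
        cases n with
        | zero => exact h
        | succ n => exact ξ.reduced n }

theorem push_word_of_eq {a : Fin k × Bool} {ξ : FreeBoundary k} (h : ξ.word 0 = letterInv a) :
    (push a ξ).word = fun n => ξ.word (n + 1) :=
  congrArg word (dif_pos h)

theorem push_word_of_ne {a : Fin k × Bool} {ξ : FreeBoundary k} (h : ξ.word 0 ≠ letterInv a) :
    (push a ξ).word = fun n => Nat.casesOn n a ξ.word :=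
  congrArg word (dif_neg h)

theorem push_letterInv_push (a : Fin k × Bool) (ξ : FreeBoundary k) :
    push (letterInv a) (push a ξ) = ξ := by
  apply FreeBoundary.ext
  by_cases h : ξ.word 0 = letterInv a
  · have e := push_word_of_eq h
    have h1 : (push a ξ).word 0 ≠ letterInv (letterInv a) := by
      rw [e, ← h]
      exact ξ.reduced 0
    rw [push_word_of_ne h1, e]
    funext n
    cases n with
    | zero => exact h.symm
    | succ n => rfl
  · have e := push_word_of_ne h
    have h0 : (push a ξ).word 0 = letterInv (letterInv a) := by
      rw [e]
      exact (letterInv_letterInv a).symm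
    rw [push_word_of_eq h0, e]

/-- Left translation of the boundary by a generator, as a bijection. -/
def pushEquiv (i : Fin k) : Equiv.Perm (FreeBoundary k) where
  toFun := push (i, true)
  invFun := push (i, false)
  left_inv ξ := push_letterInv_push (i, true) ξ
  right_inv ξ := push_letterInv_push (i, false) ξ

end FreeBoundary

variable {k : ℕ} {F : Type*} [Group F]

/-- The left translation action on the boundary of a free group with free basis `b`. -/
def boundaryAct (b : FreeGroupBasis (Fin k) F) (g : F) : Equiv.Perm (FreeBoundary k) :=
  FreeGroup.lift FreeBoundary.pushEquiv (b.repr g)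

/-- The element of the free group spelled by the first `n` letters of an infinite reduced word. -/
def boundaryPrefix (b : FreeGroupBasis (Fin k) F) (ξ : FreeBoundary k) (n : ℕ) : F :=
  b.repr.symm (FreeGroup.mk (List.ofFn fun i : Fin n => ξ.word i))

/-- The space of ordered pairs of distinct boundary points. -/
structure DoubleBoundary (k : ℕ) where
  fst : FreeBoundary k
  snd : FreeBoundary k
  ne : fst ≠ snd

/-- The subspace topology of the product topology. -/
instance (k : ℕ) : TopologicalSpace (DoubleBoundary k) :=
  TopologicalSpace.induced (fun p : DoubleBoundary k => (p.fst, p.snd)) inferInstance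

instance (k : ℕ) : MeasurableSpace (DoubleBoundary k) := borel _

instance (k : ℕ) : BorelSpace (DoubleBoundary k) := ⟨rfl⟩

/-- The diagonal left translation action on pairs of distinct boundary points. -/
def doubleBoundaryAct (b : FreeGroupBasis (Fin k) F) (g : F) (p : DoubleBoundary k) :
    DoubleBoundary k where
  fst := boundaryAct b g p.fst
  snd := boundaryAct b g p.snd
  ne h := p.ne ((boundaryAct b g).injective h)

/-- A geodesic current: a Borel measure on the space of pairs of distinct boundary points that is
finite on compact sets and invariant under translation. -/
structure GeodesicCurrent (b : FreeGroupBasis (Fin k) F) where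
  toMeasure : Measure (DoubleBoundary k)
  finite_of_isCompact : ∀ K : Set (DoubleBoundary k), IsCompact K → toMeasure K < ∞
  invariant : ∀ (g : F) (S : Set (DoubleBoundary k)), MeasurableSet S →
    toMeasure (doubleBoundaryAct b g ⁻¹' S) = toMeasure S

/-! ### Points of Outer space -/

/-- An `ℝ`-tree: a nonempty geodesic metric space that is `0`-hyperbolic (four-point condition). -/
structure IsRealTree (T : Type*) [MetricSpace T] : Prop where
  nonempty : Nonempty T
  geodesic : ∀ x y : T, ∃ γ : ℝ → T, γ 0 = x ∧ γ (dist x y) = y ∧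
    ∀ s ∈ Icc 0 (dist x y), ∀ t ∈ Icc 0 (dist x y), dist (γ s) (γ t) = |s - t|
  four_point : ∀ x y z w : T,
    dist x y + dist z w ≤ max (dist x z + dist y w) (dist x w + dist y z)

/-- A subtree: a nonempty subset that contains the geodesic segment between any two of its
points. -/
def IsSubtree {T : Type*} [MetricSpace T] (Y : Set T) : Prop :=
  Y.Nonempty ∧ ∀ x ∈ Y, ∀ y ∈ Y, ∀ z, dist x z + dist z y = dist x y → z ∈ Y

/-- `T` with its action of `F` represents a point of the nonprojectivized Outer space `cv(F)`:
a minimal free and discrete isometric action on an `ℝ`-tree. -/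
structure IsOuterSpaceTree (F : Type*) [Group F] (T : Type*) [MetricSpace T] [MulAction F T] :
    Prop where
  tree : IsRealTree T
  isometric : ∀ g : F, Isometry fun x : T => g • x
  free : ∀ (g : F) (x : T), g • x = x → g = 1
  discrete : ∀ x : T, DiscreteTopology (MulAction.orbit F x)
  minimal : ∀ Y : Set T, IsSubtree Y → (∀ (g : F), ∀ y ∈ Y, g • y ∈ Y) → Y = univ

/-! ### Cylinders and tameness -/

section Tree

variable {T : Type*} [MetricSpace T]

/-- The Gromov product `(x | y)_p`. -/
def gromovProduct (p x y : T) : ℝ := (dist p x + dist p y - dist x y) / 2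

variable [MulAction F T]

/-- The geodesic ray `ρ` (restricted to large times) ends at the boundary point of `T` that the
orbit map `F → T` assigns to `ξ`: the orbit of the prefixes of `ξ` and the points of the ray
converge to the same point at infinity. -/
def EndsAt (b : FreeGroupBasis (Fin k) F) (ρ : ℝ → T) (ξ : FreeBoundary k) : Prop :=
  ∀ p : T, Tendsto (fun q : ℕ × ℝ => gromovProduct p (boundaryPrefix b ξ q.1 • p) (ρ q.2))
    (atTop ×ˢ atTop) atTop

/-- The two-sided cylinder of `[x, y]`: the pairs `(ξ, ζ)` such that the oriented bi-infinite
geodesic of `T` from `ξ` to `ζ` contains `[x, y]` with agreeing orientation. -/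
def cylinder (b : FreeGroupBasis (Fin k) F) (x y : T) : Set (DoubleBoundary k) :=
  {p | ∃ γ : ℝ → T, Isometry γ ∧ EndsAt b (fun t => γ (-t)) p.fst ∧ EndsAt b γ p.snd ∧
    ∃ s t : ℝ, s ≤ t ∧ γ s = x ∧ γ t = y}

end Tree

/-- The current `μ` is tame with respect to the tree `T`. -/
def IsTame {b : FreeGroupBasis (Fin k) F} (μ : GeodesicCurrent b) (T : Type*) [MetricSpace T]
    [MulAction F T] : Prop :=
  ∀ M : ℝ, 1 ≤ M → ∃ C : ℝ≥0, 1 ≤ C ∧ ∀ a₁ b₁ a₂ b₂ : T,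
    dist a₁ a₂ ≤ M → dist b₁ b₂ ≤ M → a₁ ≠ b₁ → a₂ ≠ b₂ →
      (1 / (C : ℝ≥0∞)) * μ.toMeasure (cylinder b a₂ b₂) ≤ μ.toMeasure (cylinder b a₁ b₁) ∧
      μ.toMeasure (cylinder b a₁ b₁) ≤ C * μ.toMeasure (cylinder b a₂ b₂)

end

/-! Tameness for any `T` in Outer space is equivalent to tameness for one fixed model, the Cayley
tree of the basis (`isTame_iff_isCayleyTame`); the theorem follows by applying this equivalence to
`T` and to `T'`.

The comparison rests on three properties of an orbit map `g ↦ g • o`, collected in `OrbitControl`: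
it is Lipschitz, it is uniformly proper, and it has bounded cancellation. Properness comes from
freeness, discreteness and the cocompactness that minimality provides. Bounded cancellation says
that a word geodesic through `y` has an image whose endpoints are joined by a segment passing within
`D` of `y • o`.

These properties give cylinder inclusions both ways. A Cayley cylinder of `[g, h]` lies in the tree
cylinder of the image segment trimmed by `D` at both ends (`cayleyCylinder_subset_cylinder`).
Conversely, a line of `T` through two points is followed by a Cayley line passing near them
(`exists_near_of_mem_cylinder`), so the tree cylinder of the image of a prolongation of `[g, h]`
lies in the Cayley cylinder of `[g, h]`.

To bound one cylinder by another of the same kind, the first is covered by boundedly many cylinders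
of the other kind with endpoints at bounded distance, and the second contains one such cylinder.
Tameness of the other kind compares the pieces, and a union bound (`measure_le_card_mul_of_cover`)
multiplies the constant by the size of a product of two balls in `F`.

The word metric and the metric of `T` both satisfy the four-point condition, so betweenness
arguments are made once, for `IsTreeDist`. -/

/-! ### Zero-hyperbolic distances -/

/-- A distance function satisfying the four-point condition. -/
structure IsTreeDist {X : Type*} (d : X → X → ℝ) : Prop where
  self : ∀ x, d x x = 0
  symm : ∀ x y, d x y = d y x
  eq_of_eq_zero : ∀ x y, d x y = 0 → x = y
  triangle : ∀ x y z, d x z ≤ d x y + d y z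
  four_point : ∀ x y z w, d x y + d z w ≤ max (d x z + d y w) (d x w + d y z)

/-- The point `z` lies on a geodesic from `x` to `y`. -/
def OnGeod {X : Type*} (d : X → X → ℝ) (x z y : X) : Prop := d x z + d z y = d x y

namespace IsTreeDist

variable {X : Type*} {d : X → X → ℝ}


theorem nonneg (hd : IsTreeDist d) (x y : X) : 0 ≤ d x y := by
  have h1 := hd.triangle x y x
  rw [hd.self, hd.symm y x] at h1
  linarith

theorem btw_symm (hd : IsTreeDist d) {x z y : X} (h : OnGeod d x z y) : OnGeod d y z x := by
  unfold OnGeod at *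
  rw [hd.symm y z, hd.symm z x, hd.symm y x]
  linarith

theorem btw_left (hd : IsTreeDist d) (x y : X) : OnGeod d x x y := by
  simp [OnGeod, hd.self]

theorem btw_of_le (hd : IsTreeDist d) {x z y : X} (h : d x z + d z y ≤ d x y) : OnGeod d x z y :=
  le_antisymm h (hd.triangle x z y)

/-- If `p` separates `x` from `y`, and `y`, `z` lie in the same direction at `p`, then `p`
separates `x` from `z`. -/
theorem btw_trans_right (hd : IsTreeDist d) {x p y z : X} (h : OnGeod d x p y) (h' : d y z < d p y + d p z) :
    OnGeod d x p z := by
  apply hd.btw_of_le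
  unfold OnGeod at h
  have h4 := hd.four_point x y p z
  rcases le_max_iff.1 h4 with h5 | h5
  · linarith
  · rw [hd.symm y p] at h5
    linarith

/-- The four-point inequality for `z, z', x, y` reads `d z z' + d x y ≤ d x y`, since both pairings
on the right have sum `d x y`. -/
theorem eq_of_btw (hd : IsTreeDist d) {x y z z' : X} (h : OnGeod d x z y) (h' : OnGeod d x z' y) (e : d x z = d x z') :
    z = z' := by
  apply hd.eq_of_eq_zero
  unfold OnGeod at *
  have h4 := hd.four_point z z' x y
  have := hd.nonneg z z'
  rw [hd.symm z x, hd.symm z' x] at h4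
  rcases le_max_iff.1 h4 with h5 | h5 <;> linarith

/-- Of two geodesic segments sharing an endpoint, one of which passes within `D` of the far end of
the other, the first contains the part of the second beyond `D`. -/
theorem btw_of_gromov (hd : IsTreeDist d) {W G H x : X} {D : ℝ} (h : OnGeod d G x H)
    (hD : d W G + d G H - d W H ≤ 2 * D) (hx : D ≤ d G x) : OnGeod d W x H := by
  apply hd.btw_of_le
  unfold OnGeod at h
  have h4 := hd.four_point W x G H
  rw [hd.symm x G] at h4
  rcases le_max_iff.1 h4 with h5 | h5 <;> linarith

/-- Geodesics that overlap in a nondegenerate segment concatenate. With `a = b` the path could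
backtrack at the common point, hence the condition `0 < d a b`. -/
theorem add_eq_of_btw (hd : IsTreeDist d) {x a b y : X} (h : OnGeod d x a b) (h' : OnGeod d a b y) (hab : 0 < d a b) :
    d x a + d a b + d b y = d x y := by
  have h1 : OnGeod d x a y := by
    apply hd.btw_trans_right h
    unfold OnGeod at h'
    linarith
  unfold OnGeod at *
  linarith

/-- If `p` is on a geodesic from `x` to `y`, then for each `z` it is on one of the geodesics from
`z` to `x` or `y`. -/
theorem btw_or_btw (hd : IsTreeDist d) {x p y : X} (h : OnGeod d x p y) (z : X) : OnGeod d x p z ∨ OnGeod d z p y := by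
  by_cases h' : d y z < d p y + d p z
  · exact Or.inl (hd.btw_trans_right h h')
  · right
    apply hd.btw_of_le
    rw [hd.symm z p, hd.symm z y]
    linarith

/-- A sequence that is locally geodesic with unit steps is geodesic. -/
theorem dist_of_local (hd : IsTreeDist d) {x : ℕ → X} (h1 : ∀ n, d (x n) (x (n + 1)) = 1)
    (h2 : ∀ n, d (x n) (x (n + 2)) = 2) (n : ℕ) : d (x 0) (x n) = n := by
  induction n using Nat.strong_induction_on with
  | _ n ih =>
    match n with
    | 0 => simp [hd.self]
    | 1 => simpa using h1 0
    | n + 2 =>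
      have e1 := ih (n + 1) (by omega)
      have e0 := ih n (by omega)
      have b : OnGeod d (x 0) (x n) (x (n + 1)) := by
        unfold OnGeod
        rw [e0, h1, e1]
        push_cast
        ring
      have b' : OnGeod d (x n) (x (n + 1)) (x (n + 2)) := by
        unfold OnGeod
        rw [h1, h1 (n + 1), h2]
        norm_num
      have := hd.add_eq_of_btw b b' (by rw [h1]; norm_num)
      rw [← this, e0, h1, h1 (n + 1)]
      push_cast
      ring

theorem dist_of_local_int (hd : IsTreeDist d) {x : ℤ → X} (h1 : ∀ n, d (x n) (x (n + 1)) = 1)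
    (h2 : ∀ n, d (x n) (x (n + 2)) = 2) (i j : ℤ) : d (x i) (x j) = |(i : ℝ) - j| := by
  have key : ∀ (i : ℤ) (n : ℕ), d (x i) (x (i + n)) = n := fun i n => by
    have := hd.dist_of_local (x := fun n : ℕ => x (i + n))
      (fun n => by simpa [add_assoc] using h1 (i + n))
      (fun n => by simpa [add_assoc] using h2 (i + n)) n
    simpa using this
  rcases le_total i j with h | h
  · obtain ⟨n, rfl⟩ := Int.le.dest h
    rw [key]
    simp
  · obtain ⟨n, rfl⟩ := Int.le.dest h
    rw [hd.symm, key]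
    simp

end IsTreeDist

/-! ### The word metric of a free group -/

namespace FreeGroup

variable {α : Type*} [DecidableEq α]

theorem norm_mk_of_isReduced {L : List (α × Bool)} (h : IsReduced L) :
    (mk L).norm = L.length := by
  rw [norm, toWord_mk, h.reduce_eq]

theorem isReduced_invRev {L : List (α × Bool)} (h : IsReduced L) : IsReduced (invRev L) := by
  rw [isReduced_iff_reduce_eq, reduce_invRev, h.reduce_eq]

theorem isReduced_invRev_append {L M : List (α × Bool)} (hL : IsReduced L) (hM : IsReduced M)
    (h : ∀ a ∈ L.head?, ∀ b ∈ M.head?, a ≠ b) : IsReduced (invRev L ++ M) := by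
  unfold IsReduced
  rw [List.isChain_append]
  refine ⟨isReduced_invRev hL, hM, ?_⟩
  intro x hx y hy hxy
  cases L with
  | nil => simp at hx
  | cons a L =>
    rw [invRev_cons] at hx
    simp only [invRev, List.map_cons, List.map_nil, List.reverse_singleton,
      List.getLast?_append, List.getLast?_singleton, Option.some_or, Option.mem_def,
      Option.some.injEq] at hx
    have := h a (by simp) y hy
    subst hx
    obtain ⟨a1, a2⟩ := a
    obtain ⟨y1, y2⟩ := y
    simp only at hxy ⊢
    subst hxy
    by_contra hc
    apply this
    cases a2 <;> cases y2 <;> simp_all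

theorem norm_mk_inv_mul_mk {L M : List (α × Bool)} (hL : IsReduced L) (hM : IsReduced M)
    (h : ∀ a ∈ L.head?, ∀ b ∈ M.head?, a ≠ b) :
    ((mk L)⁻¹ * mk M).norm = L.length + M.length := by
  rw [inv_mk, mul_mk, norm_mk_of_isReduced (isReduced_invRev_append hL hM h)]
  simp

theorem mk_cons_inv_mul_mk_cons {α : Type*} (a : α × Bool) (L M : List (α × Bool)) :
    (mk (a :: L))⁻¹ * mk (a :: M) = (mk L)⁻¹ * mk M := by
  have e : ∀ L : List (α × Bool), mk (a :: L) = mk [a] * mk L := fun L => by simp [mul_mk]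
  rw [e L, e M]
  group

/-- The four-point condition, based at `1`, for reduced words. -/
theorem norm_four_point_mk (L : List (α × Bool)) : ∀ M N : List (α × Bool), IsReduced L →
    IsReduced M → IsReduced N →
    ((mk L)⁻¹ * mk N).norm + M.length ≤
      max (((mk L)⁻¹ * mk M).norm + N.length) (((mk M)⁻¹ * mk N).norm + L.length) := by
  induction L with
  | nil =>
    intro M N _ hM hN
    have h1 := norm_mk_inv_mul_mk (L := []) IsReduced.nil hM (by simp)
    have h2 := norm_mk_inv_mul_mk (L := []) IsReduced.nil hN (by simp)
    rw [h1, h2]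
    simp [add_comm]
  | cons a L ih =>
    intro M N hL hM hN
    have tri : ((mk (a :: L))⁻¹ * mk N).norm ≤ (a :: L).length + N.length := by
      refine (norm_mul_le _ _).trans ?_
      rw [norm_inv_eq]
      exact add_le_add norm_mk_le norm_mk_le
    -- If the first letters of `L` and `M`, or of `M` and `N`, do not match, nothing cancels in that
    -- quotient and the triangle inequality suffices. Otherwise all three words share their first
    -- letter, which can be stripped.
    by_cases h1 : ∀ x ∈ (a :: L).head?, ∀ b ∈ M.head?, x ≠ b
    · rw [norm_mk_inv_mul_mk hL hM h1]
      apply le_max_of_le_left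
      omega
    by_cases h2 : ∀ x ∈ M.head?, ∀ b ∈ N.head?, x ≠ b
    · rw [norm_mk_inv_mul_mk hM hN h2]
      apply le_max_of_le_right
      omega
    cases M with
    | nil => simp at h1
    | cons b M =>
      cases N with
      | nil => simp at h2
      | cons c N =>
        simp only [List.head?_cons, Option.mem_def, Option.some.injEq, forall_eq', ne_eq,
          not_not] at h1 h2
        subst h1
        subst h2
        rw [mk_cons_inv_mul_mk_cons, mk_cons_inv_mul_mk_cons, mk_cons_inv_mul_mk_cons]
        have := ih M N (hL.infix (List.suffix_cons _ _).isInfix)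
          (hM.infix (List.suffix_cons _ _).isInfix) (hN.infix (List.suffix_cons _ _).isInfix)
        simp only [List.length_cons]
        omega

theorem norm_four_point (x y z : FreeGroup α) :
    (x⁻¹ * z).norm + y.norm ≤ max ((x⁻¹ * y).norm + z.norm) ((y⁻¹ * z).norm + x.norm) := by
  have := norm_four_point_mk x.toWord y.toWord z.toWord isReduced_toWord isReduced_toWord
    isReduced_toWord
  simpa only [mk_toWord, norm] using this

theorem finite_norm_le [Finite α] (n : ℕ) : {x : FreeGroup α | x.norm ≤ n}.Finite :=
  (List.finite_length_le (α × Bool) n).preimage toWord_injective.injOn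

end FreeGroup

/-! ### The Cayley tree of a free basis. -/

section Cayley

variable {k : ℕ} {F : Type*} [Group F]

/-- The element of `F` spelled by a letter. -/
noncomputable def letterElt (b : FreeGroupBasis (Fin k) F) (a : Fin k × Bool) : F :=
  b.repr.symm (FreeGroup.mk [a])

/-- The word metric of `F` with respect to the basis `b`. -/
noncomputable def cdist (b : FreeGroupBasis (Fin k) F) (x y : F) : ℝ := ((b.repr (x⁻¹ * y)).norm : ℕ)

variable (b : FreeGroupBasis (Fin k) F)

theorem cdist_mul_left (g x y : F) : cdist b (g * x) (g * y) = cdist b x y := by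
  unfold cdist
  congr 3
  group

theorem isTreeDist_cdist : IsTreeDist (cdist b) where
  self x := by simp [cdist]
  symm x y := by
    unfold cdist
    rw [← FreeGroup.norm_inv_eq, ← map_inv]
    simp
  eq_of_eq_zero x y h := by
    unfold cdist at h
    rw [Nat.cast_eq_zero, FreeGroup.norm_eq_zero, map_eq_one_iff _ b.repr.injective,
      inv_mul_eq_one] at h
    exact h
  triangle x y z := by
    unfold cdist
    have : x⁻¹ * z = (x⁻¹ * y) * (y⁻¹ * z) := by group
    rw [this, map_mul]
    exact_mod_cast FreeGroup.norm_mul_le _ _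
  four_point x y z w := by
    -- Translation by `w⁻¹` moves the fourth point to the base point `1`.
    have h := FreeGroup.norm_four_point (b.repr (w⁻¹ * x)) (b.repr (w⁻¹ * z)) (b.repr (w⁻¹ * y))
    simp only [← map_inv, ← map_mul, mul_inv_rev, inv_inv] at h
    have e : ∀ u v : F, u⁻¹ * w * (w⁻¹ * v) = u⁻¹ * v := fun u v => by group
    simp only [e] at h
    have s : ∀ u v : F, (b.repr (u⁻¹ * v)).norm = (b.repr (v⁻¹ * u)).norm := fun u v => by
      rw [← FreeGroup.norm_inv_eq, ← map_inv]
      simp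
    rw [s w z, s w y, s w x, s z y] at h
    unfold cdist
    rw [max_comm] at h
    rw [max_comm]
    have h' : ((b.repr (x⁻¹ * y)).norm : ℝ) + (b.repr (z⁻¹ * w)).norm ≤
        max (((b.repr (y⁻¹ * z)).norm : ℝ) + (b.repr (x⁻¹ * w)).norm)
          (((b.repr (x⁻¹ * z)).norm : ℝ) + (b.repr (y⁻¹ * w)).norm) := by
      exact_mod_cast h
    rwa [add_comm ((b.repr (y⁻¹ * z)).norm : ℝ)] at h'

theorem letterElt_letterInv (a : Fin k × Bool) :
    letterElt b (letterInv a) = (letterElt b a)⁻¹ := by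
  unfold letterElt
  rw [← map_inv, FreeGroup.inv_mk]
  rfl

theorem cdist_mul_letterElt (x : F) (a : Fin k × Bool) : cdist b x (x * letterElt b a) = 1 := by
  simp [cdist, letterElt, FreeGroup.norm_mk_of_isReduced FreeGroup.IsReduced.singleton]

theorem cdist_letterElt_letterElt (x : F) {a c : Fin k × Bool} (h : a ≠ c) :
    cdist b (x * letterElt b a) (x * letterElt b c) = 2 := by
  rw [cdist_mul_left]
  unfold cdist letterElt
  rw [map_mul, map_inv, MulEquiv.apply_symm_apply, MulEquiv.apply_symm_apply,
    FreeGroup.norm_mk_inv_mul_mk FreeGroup.IsReduced.singleton FreeGroup.IsReduced.singleton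
    (by simpa using h)]
  norm_num

theorem cdist_letterElt_add (u : F) (a : Fin k × Bool)
    (h : ∀ c ∈ (b.repr u).toWord.head?, a ≠ c) :
    cdist b (letterElt b a) u = cdist b 1 u + 1 := by
  unfold cdist letterElt
  rw [map_mul, map_inv, MulEquiv.apply_symm_apply, ← FreeGroup.mk_toWord (x := b.repr u),
    FreeGroup.norm_mk_inv_mul_mk FreeGroup.IsReduced.singleton FreeGroup.isReduced_toWord
    (by simpa using h)]
  simp [FreeGroup.norm]
  ring

/-- There is a neighbour one step further away. -/
theorem exists_letter_cdist_add_one (hk : 2 ≤ k) (x y : F) :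
    ∃ a, cdist b (x * letterElt b a) y = cdist b x y + 1 := by
  have i : Fin k := ⟨0, by omega⟩
  have : ∃ a : Fin k × Bool, ∀ c ∈ (b.repr (x⁻¹ * y)).toWord.head?, a ≠ c := by
    cases h : (b.repr (x⁻¹ * y)).toWord.head? with
    | none => exact ⟨(i, true), by simp⟩
    | some c =>
      refine ⟨(c.1, !c.2), ?_⟩
      simp [Prod.ext_iff]
  obtain ⟨a, ha⟩ := this
  refine ⟨a, ?_⟩
  have := cdist_letterElt_add b (x⁻¹ * y) a ha
  have e1 := cdist_mul_left b x (letterElt b a) (x⁻¹ * y)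
  have e2 := cdist_mul_left b x 1 (x⁻¹ * y)
  simp only [mul_inv_cancel_left, mul_one] at e1 e2
  rw [e1, e2, this]

/-- There is a neighbour one step closer. -/
theorem exists_letter_cdist_sub_one {x y : F} (h : x ≠ y) :
    ∃ a, cdist b (x * letterElt b a) y + 1 = cdist b x y := by
  cases e : (b.repr (x⁻¹ * y)).toWord with
  | nil =>
    exfalso
    apply h
    rwa [FreeGroup.toWord_eq_nil_iff, map_eq_one_iff _ b.repr.injective, inv_mul_eq_one] at e
  | cons a L =>
    refine ⟨a, ?_⟩
    have hr : FreeGroup.IsReduced (a :: L) := e ▸ FreeGroup.isReduced_toWord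
    have e' : b.repr (x⁻¹ * y) = FreeGroup.mk [a] * FreeGroup.mk L := by
      rw [← FreeGroup.mk_toWord (x := b.repr (x⁻¹ * y)), e, FreeGroup.mul_mk]
      rfl
    unfold cdist
    have e3 : (x * letterElt b a)⁻¹ * y = (letterElt b a)⁻¹ * (x⁻¹ * y) := by group
    rw [e3, map_mul, e', map_inv, letterElt, MulEquiv.apply_symm_apply, inv_mul_cancel_left,
      FreeGroup.mul_mk, List.singleton_append, FreeGroup.norm_mk_of_isReduced hr,
      FreeGroup.norm_mk_of_isReduced (hr.infix (List.suffix_cons _ _).isInfix)]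
    simp

theorem cdist_nat (x y : F) : ∃ n : ℕ, cdist b x y = n := ⟨_, rfl⟩

theorem finite_cdist_le (x : F) (r : ℝ) : {y | cdist b x y ≤ r}.Finite := by
  have h1 := (FreeGroup.finite_norm_le (α := Fin k) ⌊r⌋₊).preimage b.repr.injective.injOn
  have h2 := h1.preimage (mul_right_injective x⁻¹).injOn
  refine h2.subset fun y hy => ?_
  exact Nat.le_floor hy

/-- There is a point at distance `n` behind `x`, as seen from `y`. -/
theorem exists_extension (hk : 2 ≤ k) (x y : F) (n : ℕ) :
    ∃ z, cdist b z x = n ∧ OnGeod (cdist b) z x y := by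
  have hd := isTreeDist_cdist b
  induction n with
  | zero => exact ⟨x, by simp [hd.self], hd.btw_left x y⟩
  | succ n ih =>
    obtain ⟨z, hz, hb⟩ := ih
    obtain ⟨a, ha⟩ := exists_letter_cdist_add_one b hk z y
    have h1 := cdist_mul_letterElt b z a
    rw [hd.symm] at h1
    unfold OnGeod at *
    have h2 := hd.triangle (z * letterElt b a) z x
    have h3 := hd.triangle (z * letterElt b a) x y
    refine ⟨z * letterElt b a, ?_, ?_⟩
    · push_cast
      linarith
    · linarith

/-! ### Bi-infinite geodesics in the Cayley tree -/

theorem boundaryPrefix_succ (ξ : FreeBoundary k) (n : ℕ) :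
    boundaryPrefix b ξ (n + 1) = boundaryPrefix b ξ n * letterElt b (ξ.word n) := by
  unfold boundaryPrefix letterElt
  rw [← map_mul, FreeGroup.mul_mk, List.ofFn_succ_last]
  rfl

/-- The bi-infinite geodesic `w` of the Cayley tree runs from `p.fst` to `p.snd`. -/
def IsCayleyLine (w : ℤ → F) (p : DoubleBoundary k) : Prop :=
  (∀ i j : ℤ, cdist b (w i) (w j) = |(i : ℝ) - j|) ∧
    ∃ N : ℕ, ∀ n : ℕ, w (-n) = boundaryPrefix b p.fst (N + n) ∧
      w n = boundaryPrefix b p.snd (N + n)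

theorem cdist_boundaryPrefix_one (ξ : FreeBoundary k) (n : ℕ) :
    cdist b (boundaryPrefix b ξ n) (boundaryPrefix b ξ (n + 1)) = 1 := by
  rw [boundaryPrefix_succ, cdist_mul_letterElt]

theorem cdist_boundaryPrefix_two (ξ : FreeBoundary k) (n : ℕ) :
    cdist b (boundaryPrefix b ξ n) (boundaryPrefix b ξ (n + 2)) = 2 := by
  have e : boundaryPrefix b ξ n =
      boundaryPrefix b ξ (n + 1) * letterElt b (letterInv (ξ.word n)) := by
    rw [boundaryPrefix_succ, letterElt_letterInv, mul_inv_cancel_right]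
  rw [e, boundaryPrefix_succ b ξ (n + 1)]
  exact cdist_letterElt_letterElt b _ (ξ.reduced n).symm

/-- The two infinite words are cut at the first index `N` where they differ, and their rays are
glued at the common prefix of length `N`. The result is locally geodesic, hence geodesic: away from
the gluing point because the words are reduced, at it because the `N`-th letters differ. -/
theorem exists_isCayleyLine (p : DoubleBoundary k) : ∃ w : ℤ → F, IsCayleyLine b w p := by
  classical
  have hd := isTreeDist_cdist b
  have hne : ∃ n, p.fst.word n ≠ p.snd.word n := by
    by_contra! h
    exact p.ne (FreeBoundary.ext (funext h))
  obtain ⟨N, hN, hmin⟩ : ∃ N, p.fst.word N ≠ p.snd.word N ∧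
      ∀ m < N, p.fst.word m = p.snd.word m :=
    ⟨Nat.find hne, Nat.find_spec hne, fun m hm => not_not.1 (Nat.find_min hne hm)⟩
  have hpre : boundaryPrefix b p.fst N = boundaryPrefix b p.snd N := by
    unfold boundaryPrefix
    congr 2
    exact congrArg List.ofFn (funext fun i => hmin i i.2)
  let w : ℤ → F := fun
    | Int.ofNat n => boundaryPrefix b p.snd (N + n)
    | Int.negSucc n => boundaryPrefix b p.fst (N + (n + 1))
  have w1 : ∀ n : ℕ, w n = boundaryPrefix b p.snd (N + n) := fun n => rfl
  have w2 : ∀ n : ℕ, w (-n) = boundaryPrefix b p.fst (N + n) := fun n => by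
    cases n with
    | zero => exact hpre.symm
    | succ n => rfl
  refine ⟨w, hd.dist_of_local_int ?_ ?_, N, fun n => ⟨w2 n, w1 n⟩⟩
  · intro i
    rcases lt_or_ge i 0 with hi | hi
    · obtain ⟨n, rfl⟩ : ∃ n : ℕ, i = -((n + 1 : ℕ) : ℤ) := ⟨(-i - 1).toNat, by omega⟩
      rw [show -((n + 1 : ℕ) : ℤ) + 1 = -(n : ℤ) by push_cast; ring, w2, w2, hd.symm]
      exact cdist_boundaryPrefix_one b _ _
    · obtain ⟨n, rfl⟩ : ∃ n : ℕ, i = n := ⟨i.toNat, by omega⟩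
      rw [show (n : ℤ) + 1 = ((n + 1 : ℕ) : ℤ) by push_cast; ring, w1, w1]
      exact cdist_boundaryPrefix_one b _ _
  · intro i
    rcases lt_or_ge i (-1) with hi | hi
    · obtain ⟨n, rfl⟩ : ∃ n : ℕ, i = -((n + 2 : ℕ) : ℤ) := ⟨(-i - 2).toNat, by omega⟩
      rw [show -((n + 2 : ℕ) : ℤ) + 2 = -(n : ℤ) by push_cast; ring, w2, w2, hd.symm]
      exact cdist_boundaryPrefix_two b _ _
    · rcases eq_or_lt_of_le hi with hi | hi
      · subst hi
        -- The window from `-1` to `1` is the only one that straddles the branching vertex.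
        rw [show (-1 : ℤ) = -((1 : ℕ) : ℤ) by simp, w2,
          show -((1 : ℕ) : ℤ) + 2 = ((1 : ℕ) : ℤ) by norm_num, w1, boundaryPrefix_succ,
          boundaryPrefix_succ, hpre]
        exact cdist_letterElt_letterElt b _ hN
      · obtain ⟨n, rfl⟩ : ∃ n : ℕ, i = n := ⟨i.toNat, by omega⟩
        rw [show (n : ℤ) + 2 = ((n + 2 : ℕ) : ℤ) by push_cast; ring, w1, w1]
        exact cdist_boundaryPrefix_two b _ _

variable {b}

/-- A point between two points of a line is on the line. -/
theorem IsCayleyLine.exists_eq {w : ℤ → F} {p : DoubleBoundary k} (hw : IsCayleyLine b w p)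
    {i j : ℤ} (hij : i ≤ j) {f : F} (hf : OnGeod (cdist b) (w i) f (w j)) :
    ∃ m, i ≤ m ∧ m ≤ j ∧ w m = f := by
  have hd := isTreeDist_cdist b
  obtain ⟨n, hn⟩ := cdist_nat b (w i) f
  have hij' : (i : ℝ) ≤ j := by exact_mod_cast hij
  have hnj : i + n ≤ j := by
    have h1 := hd.nonneg f (w j)
    unfold OnGeod at hf
    rw [hw.1 i j, hn, abs_of_nonpos (by linarith)] at hf
    have : (i : ℝ) + n ≤ j := by linarith
    exact_mod_cast this
  refine ⟨i + n, by omega, hnj, ?_⟩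
  have hnj' : (i : ℝ) + n ≤ j := by exact_mod_cast hnj
  have hn0 : (0 : ℝ) ≤ n := n.cast_nonneg
  refine hd.eq_of_btw (x := w i) (y := w j) ?_ hf ?_
  · unfold OnGeod
    rw [hw.1, hw.1, hw.1]
    push_cast
    rw [abs_of_nonpos (by linarith), abs_of_nonpos (by linarith), abs_of_nonpos (by linarith)]
    ring
  · rw [hw.1, hn]
    push_cast
    rw [abs_of_nonpos (by linarith)]
    ring

theorem IsCayleyLine.cdist_of_le {w : ℤ → F} {p : DoubleBoundary k} (hw : IsCayleyLine b w p)
    {i j : ℤ} (hij : i ≤ j) : cdist b (w i) (w j) = j - i := by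
  have hij' : (i : ℝ) ≤ j := by exact_mod_cast hij
  rw [hw.1, abs_of_nonpos (by linarith)]
  ring

theorem IsCayleyLine.btw {w : ℤ → F} {p : DoubleBoundary k} (hw : IsCayleyLine b w p)
    {i j l : ℤ} (hij : i ≤ j) (hjl : j ≤ l) : OnGeod (cdist b) (w i) (w j) (w l) := by
  unfold OnGeod
  rw [hw.cdist_of_le hij, hw.cdist_of_le hjl, hw.cdist_of_le (hij.trans hjl)]
  ring

variable (b)

/-- The two-sided cylinder of the segment `[g, h]` of the Cayley tree. -/
def cayleyCylinder (g h : F) : Set (DoubleBoundary k) :=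
  {p | ∃ w : ℤ → F, IsCayleyLine b w p ∧ ∃ i j : ℤ, i ≤ j ∧ w i = g ∧ w j = h}

/-- A line that passes near points `g'`, `h'` far behind `g` and `h` passes through `g` and `h`. -/
theorem mem_cayleyCylinder_of_near {w : ℤ → F} {p : DoubleBoundary k} (hw : IsCayleyLine b w p)
    {i j : ℤ} (hij : i ≤ j) {g h g' h' : F} (hg : OnGeod (cdist b) g' g h)
    (hg' : OnGeod (cdist b) g' g h') (hh : OnGeod (cdist b) g' h h')
    (h1 : cdist b (w i) g' < cdist b g' g) (h2 : cdist b (w j) h' < cdist b h h') :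
    p ∈ cayleyCylinder b g h := by
  have hd := isTreeDist_cdist b
  have n1 := hd.nonneg g (w i)
  have n2 := hd.nonneg h (w j)
  have n3 := hd.nonneg g h
  have s1 := hd.symm g g'
  have s2 := hd.symm (w i) g'
  have s3 := hd.symm (w j) h'
  have a1 : OnGeod (cdist b) (w i) g h' :=
    hd.btw_symm (hd.btw_trans_right (hd.btw_symm hg') (by linarith))
  have a2 : OnGeod (cdist b) (w i) g h :=
    hd.btw_symm (hd.btw_trans_right (hd.btw_symm hg) (by linarith))
  have c1 : cdist b g h' = cdist b g h + cdist b h h' := by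
    unfold OnGeod at *
    linarith
  have a3 : OnGeod (cdist b) (w i) h h' := by
    unfold OnGeod at *
    linarith
  have a4 : OnGeod (cdist b) (w i) h (w j) := hd.btw_trans_right a3 (by linarith)
  obtain ⟨m, hm1, hm2, rfl⟩ := hw.exists_eq hij a4
  obtain ⟨l, hl1, hl2, rfl⟩ := hw.exists_eq hm1 a2
  exact ⟨w, hw, l, m, hl2, rfl, rfl⟩

end Cayley

/-! ### Segments in real trees -/

namespace IsRealTree

variable {T : Type*} [MetricSpace T]

theorem isTreeDist (hT : IsRealTree T) : IsTreeDist (dist : T → T → ℝ) where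
  self := dist_self
  symm := dist_comm
  eq_of_eq_zero _ _ := eq_of_dist_eq_zero
  triangle := dist_triangle
  four_point := hT.four_point

theorem exists_onGeod (hT : IsRealTree T) (x y : T) {r : ℝ} (h0 : 0 ≤ r) (hr : r ≤ dist x y) :
    ∃ z, OnGeod dist x z y ∧ dist x z = r := by
  obtain ⟨γ, h1, h2, h3⟩ := hT.geodesic x y
  have e1 : dist x (γ r) = r := by
    have := h3 0 ⟨le_rfl, dist_nonneg⟩ r ⟨h0, hr⟩
    rw [h1] at this
    rw [this, zero_sub, abs_neg, abs_of_nonneg h0]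
  have e2 : dist (γ r) y = dist x y - r := by
    have := h3 r ⟨h0, hr⟩ (dist x y) ⟨dist_nonneg, le_rfl⟩
    rw [h2] at this
    rw [this, abs_of_nonpos (by linarith)]
    ring
  refine ⟨γ r, ?_, e1⟩
  unfold OnGeod
  rw [e1, e2]
  ring

theorem isCompact_segment (hT : IsRealTree T) (x y : T) : IsCompact {z | OnGeod dist x z y} := by
  obtain ⟨γ, h1, h2, h3⟩ := hT.geodesic x y
  have hc : ContinuousOn γ (Icc 0 (dist x y)) := by
    have : LipschitzOnWith 1 γ (Icc 0 (dist x y)) :=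
      LipschitzOnWith.of_dist_le_mul fun s hs t ht => by
        rw [h3 s hs t ht, Real.dist_eq]
        simp
    exact this.continuousOn
  refine (isCompact_Icc.image_of_continuousOn hc).of_isClosed_subset ?_ ?_
  · exact isClosed_eq (by fun_prop) (by fun_prop)
  · intro z hz
    have hz' : dist x z ∈ Icc 0 (dist x y) := by
      refine ⟨dist_nonneg, ?_⟩
      have : dist x z + dist z y = dist x y := hz
      linarith [dist_nonneg (x := z) (y := y)]
    refine ⟨dist x z, hz', ?_⟩
    have e1 := h3 0 ⟨le_rfl, dist_nonneg⟩ _ hz'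
    have e2 := h3 _ hz' (dist x y) ⟨dist_nonneg, le_rfl⟩
    rw [h1, zero_sub, abs_neg, abs_of_nonneg hz'.1] at e1
    rw [h2, abs_of_nonpos (by linarith [hz'.2])] at e2
    refine hT.isTreeDist.eq_of_btw (x := x) (y := y) ?_ hz e1
    unfold OnGeod
    rw [e1, e2]
    ring

/-- Three points have a median. -/
theorem exists_median (hT : IsRealTree T) (x y z : T) :
    ∃ c, OnGeod dist x c y ∧ OnGeod dist y c z ∧ OnGeod dist x c z := by
  have hd := hT.isTreeDist
  obtain ⟨c, hc, e⟩ := hT.exists_onGeod x z (r := (dist x y + dist x z - dist y z) / 2)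
    (by linarith [dist_triangle y x z, dist_comm x y])
    (by linarith [dist_triangle x z y, dist_comm y z])
  have h4 := hd.four_point y c x z
  have hc' : dist x c + dist c z = dist x z := hc
  rw [dist_comm c x, dist_comm y x] at h4
  have h5 : dist y c ≤ (dist x y + dist y z - dist x z) / 2 := by
    rcases le_max_iff.1 h4 with h5 | h5 <;> linarith
  refine ⟨c, hd.btw_of_le ?_, hd.btw_of_le ?_, hc⟩
  · rw [dist_comm c y]
    linarith
  · linarith

end IsRealTree

/-! ### Orbits in points of Outer space -/

namespace IsOuterSpaceTree

variable {k : ℕ} {F : Type*} [Group F] {T : Type*} [MetricSpace T] [MulAction F T]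

theorem dist_smul_smul (hT : IsOuterSpaceTree F T) (g : F) (x y : T) :
    dist (g • x) (g • y) = dist x y :=
  (hT.isometric g).dist_eq x y

theorem dist_smul_left (hT : IsOuterSpaceTree F T) (g : F) (x y : T) :
    dist (g • x) y = dist x (g⁻¹ • y) := by
  rw [← hT.dist_smul_smul g⁻¹, inv_smul_smul]

theorem onGeod_smul (hT : IsOuterSpaceTree F T) (g : F) {x z y : T} :
    OnGeod dist (g • x) (g • z) (g • y) ↔ OnGeod dist x z y := by
  unfold OnGeod
  rw [hT.dist_smul_smul, hT.dist_smul_smul, hT.dist_smul_smul]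

/-- A point between two orbit points is covered by a translated segment along the word path. -/
theorem exists_onGeod_letter (b : FreeGroupBasis (Fin k) F) (hk : 2 ≤ k)
    (hT : IsOuterSpaceTree F T) (p : T) {x y : F} {c : T}
    (hc : OnGeod dist (x • p) c (y • p)) :
    ∃ f a, OnGeod (cdist b) x f y ∧ OnGeod dist (f • p) c ((f * letterElt b a) • p) := by
  have hC := isTreeDist_cdist b
  have hd := hT.tree.isTreeDist
  obtain ⟨n, hn⟩ := cdist_nat b x y
  induction n generalizing x with
  | zero =>
    have e : x = y := hC.eq_of_eq_zero _ _ (by simpa using hn)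
    subst e
    have e' : x • p = c := by
      have : dist (x • p) c + dist c (x • p) = dist (x • p) (x • p) := hc
      rw [dist_self, dist_comm c] at this
      exact eq_of_dist_eq_zero (by linarith)
    subst e'
    exact ⟨x, (⟨0, by omega⟩, true), hC.btw_left _ _, hd.btw_left _ _⟩
  | succ n ih =>
    have hne : x ≠ y := by
      rintro rfl
      rw [hC.self] at hn
      norm_cast at hn
    obtain ⟨a, ha⟩ := exists_letter_cdist_sub_one b hne
    -- In the tripod spanned by `x • p`, `y • p` and the next vertex of the path, `c` lies either
    -- over the first edge or over the remaining path, where induction applies.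
    rcases hd.btw_or_btw hc ((x * letterElt b a) • p) with h | h
    · exact ⟨x, a, hC.btw_left _ _, h⟩
    · obtain ⟨f, a', hf, hf'⟩ := ih h (by push_cast at hn; linarith)
      refine ⟨f, a', hC.btw_of_le ?_, hf'⟩
      have h1 := hC.triangle x (x * letterElt b a) f
      rw [cdist_mul_letterElt] at h1
      unfold OnGeod at hf
      linarith

theorem exists_dist_letterElt_le (b : FreeGroupBasis (Fin k) F) (p : T) :
    ∃ A : ℝ, 1 ≤ A ∧ ∀ a, dist p (letterElt b a • p) ≤ A := by
  obtain ⟨A, hA⟩ := (Set.finite_range fun a => dist p (letterElt b a • p)).bddAbove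
  exact ⟨max 1 A, le_max_left _ _, fun a => (hA ⟨a, rfl⟩).trans (le_max_right _ _)⟩

theorem dist_orbit_le (b : FreeGroupBasis (Fin k) F) (hT : IsOuterSpaceTree F T) {p : T} {A : ℝ}
    (hA : ∀ a, dist p (letterElt b a • p) ≤ A) (x y : F) :
    dist (x • p) (y • p) ≤ A * cdist b x y := by
  have hC := isTreeDist_cdist b
  obtain ⟨n, hn⟩ := cdist_nat b x y
  induction n generalizing x with
  | zero =>
    have e : x = y := hC.eq_of_eq_zero _ _ (by simpa using hn)
    subst e
    simp [hC.self]
  | succ n ih =>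
    have hne : x ≠ y := by
      rintro rfl
      rw [hC.self] at hn
      norm_cast at hn
    obtain ⟨a, ha⟩ := exists_letter_cdist_sub_one b hne
    have h1 := ih (x * letterElt b a) (by push_cast at hn; linarith)
    have h2 : dist (x • p) ((x * letterElt b a) • p) ≤ A := by
      rw [mul_smul, hT.dist_smul_smul]
      exact hA a
    have h3 := dist_triangle (x • p) ((x * letterElt b a) • p) (y • p)
    rw [← ha]
    linarith

/-- By minimality the tree is the convex hull of every orbit. -/
theorem exists_onGeod_orbit (hT : IsOuterSpaceTree F T) (p z : T) :
    ∃ g h : F, OnGeod dist (g • p) z (h • p) := by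
  have hd := hT.tree.isTreeDist
  suffices H : {z : T | ∃ g h : F, OnGeod dist (g • p) z (h • p)} = univ by
    have h := mem_univ z
    rwa [← H] at h
  -- Seen from `z`, some orbit point lies in the direction of `z₁`. Otherwise `z` would separate
  -- `z₁` from both `g • p` and `h • p`, making the detour through `z` shorter than the geodesic
  -- through `z₁`.
  have key : ∀ z z₁ : T, z ≠ z₁ → (∃ g h : F, OnGeod dist (g • p) z₁ (h • p)) →
      ∃ e : F, dist z₁ (e • p) < dist z z₁ + dist z (e • p) := by
    rintro z z₁ hne ⟨g, h, hgh⟩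
    by_contra! hcon
    have h1 := hcon g
    have h2 := hcon h
    have h3 := dist_triangle (g • p) z (h • p)
    have h4 := dist_pos.2 hne
    have h5 : dist (g • p) z₁ + dist z₁ (h • p) = dist (g • p) (h • p) := hgh
    rw [dist_comm z₁ (g • p), dist_comm z (g • p)] at h1
    linarith
  apply hT.minimal
  · refine ⟨⟨p, 1, 1, ?_⟩, ?_⟩
    · rw [one_smul]
      exact hd.btw_left p p
    · intro z₁ hz₁ z₂ hz₂ z hz
      by_cases e1 : z = z₁
      · rwa [e1]
      by_cases e2 : z = z₂
      · rwa [e2]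
      obtain ⟨g, hg⟩ := key z z₁ e1 hz₁
      obtain ⟨h, hh⟩ := key z z₂ e2 hz₂
      refine ⟨g, h, ?_⟩
      have h1 : OnGeod dist z₁ z (h • p) := hd.btw_trans_right hz hh
      exact hd.btw_symm (hd.btw_trans_right (hd.btw_symm h1) hg)
  · rintro f y ⟨g, h, hgh⟩
    refine ⟨f * g, f * h, ?_⟩
    rw [mul_smul, mul_smul]
    exact (hT.onGeod_smul f).2 hgh

/-! ### Cocompactness, displacement and properness of the orbit map. -/

/-- The union of the segments from `p` to its translates by letters. -/
def domain (b : FreeGroupBasis (Fin k) F) (p : T) : Set T :=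
  ⋃ a, {z | OnGeod dist p z (letterElt b a • p)}

theorem isCompact_domain (b : FreeGroupBasis (Fin k) F) (hT : IsOuterSpaceTree F T) (p : T) :
    IsCompact (domain b p) :=
  isCompact_iUnion fun _ => hT.tree.isCompact_segment _ _

theorem exists_near (b : FreeGroupBasis (Fin k) F) (hk : 2 ≤ k)
    (hT : IsOuterSpaceTree F T) (p z : T) :
    ∃ f a, OnGeod dist (f • p) z ((f * letterElt b a) • p) := by
  obtain ⟨g, h, hgh⟩ := hT.exists_onGeod_orbit p z
  obtain ⟨f, a, -, hf⟩ := hT.exists_onGeod_letter b hk p hgh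
  exact ⟨f, a, hf⟩

theorem exists_mem_domain (b : FreeGroupBasis (Fin k) F) (hk : 2 ≤ k)
    (hT : IsOuterSpaceTree F T) (p z : T) : ∃ f : F, ∃ c ∈ domain b p, z = f • c := by
  obtain ⟨f, a, hf⟩ := hT.exists_near b hk p z
  refine ⟨f, f⁻¹ • z, mem_iUnion.2 ⟨a, ?_⟩, by simp⟩
  rw [← smul_inv_smul f z, mul_smul, hT.onGeod_smul] at hf
  exact hf

theorem exists_pos_le_dist_smul_at (hT : IsOuterSpaceTree F T) (x : T) :
    ∃ ε > 0, ∀ g : F, g ≠ 1 → ε ≤ dist x (g • x) := by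
  have := hT.discrete x
  have ho : IsOpen ({⟨x, MulAction.mem_orbit_self x⟩} : Set (MulAction.orbit F x)) :=
    isOpen_discrete _
  rw [Metric.isOpen_singleton_iff] at ho
  obtain ⟨ε, hε, h⟩ := ho
  refine ⟨ε, hε, fun g hg => ?_⟩
  by_contra! hlt
  apply hg
  apply hT.free g x
  have := h ⟨g • x, MulAction.mem_orbit x g⟩ (by rw [Subtype.dist_eq, dist_comm]; exact hlt)
  exact congrArg Subtype.val this

/-- The displacement of nontrivial elements is bounded below. -/
theorem exists_pos_le_dist_smul (b : FreeGroupBasis (Fin k) F) (hk : 2 ≤ k)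
    (hT : IsOuterSpaceTree F T) : ∃ ε > 0, ∀ (x : T) (g : F), g ≠ 1 → ε ≤ dist x (g • x) := by
  obtain ⟨p⟩ := hT.tree.nonempty
  have key : ∃ ε > 0, ∀ x ∈ domain b p, ∀ g : F, g ≠ 1 → ε ≤ dist x (g • x) := by
    refine (hT.isCompact_domain b p).induction_on
      (p := fun s => ∃ ε > 0, ∀ x ∈ s, ∀ g : F, g ≠ 1 → ε ≤ dist x (g • x)) ?_ ?_ ?_ ?_
    · exact ⟨1, one_pos, by simp⟩
    · rintro s t hst ⟨ε, h0, h⟩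
      exact ⟨ε, h0, fun x hx => h x (hst hx)⟩
    · rintro s t ⟨ε, h0, h⟩ ⟨ε', h0', h'⟩
      refine ⟨min ε ε', lt_min h0 h0', ?_⟩
      rintro x (hx | hx) g hg
      · exact (min_le_left _ _).trans (h x hx g hg)
      · exact (min_le_right _ _).trans (h' x hx g hg)
    · intro x _
      obtain ⟨ε, h0, h⟩ := hT.exists_pos_le_dist_smul_at x
      -- Displacement by `g` is 2-Lipschitz, so on a ball of radius `ε / 4` it drops by at most `ε /
      -- 2`.
      refine ⟨Metric.ball x (ε / 4), mem_nhdsWithin_of_mem_nhds (Metric.ball_mem_nhds x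
        (by positivity)), ε / 2, by positivity, fun y hy g hg => ?_⟩
      have h1 := h g hg
      have h2 := dist_triangle4 x y (g • y) (g • x)
      rw [hT.dist_smul_smul, dist_comm x y] at h2
      rw [Metric.mem_ball] at hy
      linarith
  obtain ⟨ε, h0, h⟩ := key
  refine ⟨ε, h0, fun x g hg => ?_⟩
  obtain ⟨f, c, hc, rfl⟩ := hT.exists_mem_domain b hk p x
  have h1 := h c hc (f⁻¹ * g * f) (by
    intro e
    apply hg
    have e2 : g = f * (f⁻¹ * g * f) * f⁻¹ := by group
    rw [e2, e]
    simp)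
  rwa [← hT.dist_smul_smul f, ← mul_smul, show f * (f⁻¹ * g * f) = g * f by group,
    mul_smul] at h1

/-- The orbit map is proper. -/
theorem finite_dist_orbit_le (b : FreeGroupBasis (Fin k) F) (hk : 2 ≤ k)
    (hT : IsOuterSpaceTree F T) (p : T) (R : ℝ) : {g : F | dist p (g • p) ≤ R}.Finite := by
  obtain ⟨ε, h0, hε⟩ := hT.exists_pos_le_dist_smul b hk
  set K := domain b p with hK
  have hKtb := (hT.isCompact_domain b p).totallyBounded
  rw [Metric.totallyBounded_iff] at hKtb
  -- Each such `f` is assigned a point of a finite `ε / 4`-net of `K` near its `c`. If `f` and `f'`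
  -- shared a net point, `f⁻¹ * f'` would move `c f` by less than `ε / 4 + ε / 4 + ε / 2`, so the
  -- assignment is injective.
  have hloc : ∀ x : T, {f : F | ∃ c ∈ K, dist x (f • c) < ε / 4}.Finite := by
    intro x
    obtain ⟨t, ht, htK⟩ := hKtb (ε / 4) (by positivity)
    have h1 : ∀ f : {f : F | ∃ c ∈ K, dist x (f • c) < ε / 4}, ∃ y : t, ∃ c,
        dist x ((f : F) • c) < ε / 4 ∧ dist c y < ε / 4 := by
      rintro ⟨f, c, hc, hf⟩
      obtain ⟨y, hy, hyc⟩ := mem_iUnion₂.1 (htK hc)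
      exact ⟨⟨y, hy⟩, c, hf, hyc⟩
    choose y c hc hy using h1
    have : Finite t := ht
    have hinj : Function.Injective y := by
      intro f f' e
      by_contra hne
      have h2 := hε (c f) ((f : F)⁻¹ * f') (by
        intro e'
        exact hne (Subtype.ext (inv_mul_eq_one.1 e')))
      rw [mul_smul, ← hT.dist_smul_left] at h2
      have h3 := dist_triangle ((f : F) • c f) x ((f' : F) • c f)
      have h4 := dist_triangle x ((f' : F) • c f') ((f' : F) • c f)
      have h5 := dist_triangle (c f') (y f) (c f)
      have h6 := hy f'
      rw [← e] at h6
      rw [hT.dist_smul_smul] at h4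
      linarith [hc f, hc f', hy f, dist_comm x ((f : F) • c f), dist_comm (c f) (y f : T)]
    exact Finite.of_injective y hinj
  -- Finiteness spreads outward from `p` in steps of `ε / 8`. Stepping back by `ε / 8` along the
  -- segment from `p` reaches an already listed translate of `K`, and an `ε / 8`-net of `K` leaves
  -- total error `ε / 4`, the range of `hloc`.
  have hind : ∀ n : ℕ, {f : F | ∃ c ∈ K, dist p (f • c) ≤ n * (ε / 8)}.Finite := by
    intro n
    induction n with
    | zero =>
      refine (hloc p).subset ?_
      rintro f ⟨c, hc, hf⟩
      refine ⟨c, hc, lt_of_le_of_lt hf ?_⟩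
      simp only [Nat.cast_zero, zero_mul]
      positivity
    | succ n ih =>
      obtain ⟨t, ht, htK⟩ := hKtb (ε / 8) (by positivity)
      refine (ih.biUnion fun f _ => ht.biUnion fun y _ => hloc (f • y)).subset ?_
      rintro f ⟨c, hc, hf⟩
      obtain ⟨z, hz, e⟩ := hT.tree.exists_onGeod p (f • c)
        (r := max 0 (dist p (f • c) - ε / 8)) (le_max_left _ _)
        (max_le dist_nonneg (by linarith))
      have hz' : dist p z + dist z (f • c) = dist p (f • c) := hz
      obtain ⟨f₀, c₀, hc₀, rfl⟩ := hT.exists_mem_domain b hk p z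
      obtain ⟨y, hyt, hy⟩ := mem_iUnion₂.1 (htK hc₀)
      push_cast at hf
      have hn : (0 : ℝ) ≤ n * (ε / 8) := by positivity
      refine mem_biUnion (x := f₀) ⟨c₀, hc₀, ?_⟩ (mem_biUnion hyt ⟨c, hc, ?_⟩)
      · rw [e]
        exact max_le hn (by linarith)
      · have h1 := dist_triangle (f₀ • y) (f₀ • c₀) (f • c)
        rw [hT.dist_smul_smul, dist_comm y] at h1
        rw [Metric.mem_ball] at hy
        have h2 := le_max_right 0 (dist p (f • c) - ε / 8)
        linarith
  refine (hind ⌈R / (ε / 8)⌉₊).subset fun g hg => ?_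
  refine ⟨p, mem_iUnion.2 ⟨(⟨0, by omega⟩, true), hT.tree.isTreeDist.btw_left _ _⟩, ?_⟩
  refine le_trans hg ?_
  rw [← div_le_iff₀ (by positivity)]
  exact Nat.le_ceil _

/-- Properness at `1` is uniform over `F` because both metrics are invariant under left translation.
-/
theorem exists_cdist_le (b : FreeGroupBasis (Fin k) F) (hk : 2 ≤ k)
    (hT : IsOuterSpaceTree F T) (p : T) :
    ∃ N : ℝ → ℝ, ∀ (R : ℝ) (x y : F), dist (x • p) (y • p) ≤ R → cdist b x y ≤ N R := by
  have : ∀ R : ℝ, ∃ n : ℝ, ∀ x y : F, dist (x • p) (y • p) ≤ R → cdist b x y ≤ n := by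
    intro R
    obtain ⟨n, hn⟩ := ((hT.finite_dist_orbit_le b hk p R).image fun g => cdist b 1 g).bddAbove
    refine ⟨n, fun x y hxy => ?_⟩
    rw [hT.dist_smul_left, ← mul_smul] at hxy
    have := hn ⟨x⁻¹ * y, hxy, rfl⟩
    simp only at this
    rwa [← cdist_mul_left b x, mul_one, mul_inv_cancel_left] at this
  choose N hN using this
  exact ⟨N, hN⟩

/-- Bounded cancellation for the orbit map. -/
theorem exists_bounded_cancellation (b : FreeGroupBasis (Fin k) F) (hk : 2 ≤ k)
    (hT : IsOuterSpaceTree F T) (p : T) :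
    ∃ D : ℝ, 1 ≤ D ∧ ∀ x y z : F, OnGeod (cdist b) x y z →
      dist (x • p) (y • p) + dist (y • p) (z • p) - dist (x • p) (z • p) ≤ 2 * D := by
  have hC := isTreeDist_cdist b
  obtain ⟨A, hA1, hA⟩ := exists_dist_letterElt_le b p
  obtain ⟨N, hN⟩ := hT.exists_cdist_le b hk p
  have near : ∀ {x y : F} {c : T}, OnGeod dist (x • p) c (y • p) →
      ∃ f, OnGeod (cdist b) x f y ∧ dist (f • p) c ≤ A := by
    intro x y c hc
    obtain ⟨f, a, hf, hf'⟩ := hT.exists_onGeod_letter b hk p hc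
    refine ⟨f, hf, ?_⟩
    have h1 : dist (f • p) c + dist c ((f * letterElt b a) • p) = _ := hf'
    have h2 := hA a
    rw [mul_smul, hT.dist_smul_smul] at h1
    linarith [dist_nonneg (x := c) (y := f • letterElt b a • p)]
  refine ⟨max 1 (A + A * N (2 * A)), le_max_left _ _, fun x y z h => ?_⟩
  -- The quantity to bound is twice the distance from `y • p` to the median `c`. The point `c` is
  -- `A`-close to orbit points of some `f` in `[x, y]` and `f'` in `[y, z]`, so `f` and `f'` are
  -- close in `F`. As `y` lies between them, `f` is close to `y`.
  obtain ⟨c, hxy, hyz, hxz⟩ := hT.tree.exists_median (x • p) (y • p) (z • p)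
  obtain ⟨f, hf, hfc⟩ := near hxy
  obtain ⟨f', hf', hfc'⟩ := near hyz
  have h1 : cdist b f f' ≤ N (2 * A) := by
    apply hN
    linarith [dist_triangle_right (f • p) (f' • p) c]
  have h2 : cdist b f y ≤ N (2 * A) := by
    unfold OnGeod at hf hf' h
    linarith [hC.triangle x f f', hC.triangle x f' z, hC.nonneg y f']
  have h3 : dist (f • p) (y • p) ≤ A * N (2 * A) :=
    (hT.dist_orbit_le b hA f y).trans (mul_le_mul_of_nonneg_left h2 (by linarith))
  have h4 := dist_triangle (y • p) (f • p) c
  have h5 := le_max_right 1 (A + A * N (2 * A))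
  unfold OnGeod at hxy hyz hxz
  linarith [dist_comm (y • p) (f • p), dist_comm c (y • p)]

/-- There is a point on the axis of some element. -/
theorem exists_axis (b : FreeGroupBasis (Fin k) F) (hk : 2 ≤ k) (hT : IsOuterSpaceTree F T) :
    ∃ (p : T) (s : F), s ≠ 1 ∧ OnGeod dist (s⁻¹ • p) p (s • p) := by
  have hd := hT.tree.isTreeDist
  obtain ⟨x⟩ := hT.tree.nonempty
  have hC := isTreeDist_cdist b
  set s : F := letterElt b (⟨0, by omega⟩, true) with hs
  have hs1 : s ≠ 1 := by
    intro e
    have := cdist_mul_letterElt b 1 (⟨0, by omega⟩, true)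
    rw [← hs, e, mul_one, hC.self] at this
    norm_num at this
  -- The midpoint of `[x, s • x]` is on the axis of `s`: `m` and `s • m` are equidistant from `s •
  -- x` and distinct by freeness, so neither separates the other from `s • x`.
  obtain ⟨m, hm, e⟩ := hT.tree.exists_onGeod x (s • x) (r := dist x (s • x) / 2)
    (by positivity) (by linarith [dist_nonneg (x := x) (y := s • x)])
  refine ⟨m, s, hs1, ?_⟩
  have hm' : dist x m + dist m (s • x) = dist x (s • x) := hm
  have e2 : dist m (s • x) = dist x (s • x) / 2 := by linarith
  have hsm : OnGeod dist (s • x) (s • m) (s • s • x) := (hT.onGeod_smul s).2 hm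
  have e3 : dist (s • x) (s • m) = dist x (s • x) / 2 := by rw [hT.dist_smul_smul, e]
  have e4 : dist (s • m) (s • s • x) = dist x (s • x) / 2 := by rw [hT.dist_smul_smul, e2]
  have hpos : 0 < dist m (s • m) := by
    rw [dist_pos]
    exact fun h => hs1 (hT.free s m h.symm)
  have hy : OnGeod dist m (s • m) (s • s • x) := by
    rcases hd.btw_or_btw hsm m with h | h
    · exfalso
      have h1 : dist (s • x) (s • m) + dist (s • m) m = dist (s • x) m := h
      linarith [dist_comm (s • m) m, dist_comm (s • x) m]
    · exact h
  have hx : OnGeod dist x m (s • m) := by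
    rcases hd.btw_or_btw hm (s • m) with h | h
    · exact h
    · exfalso
      have h1 : dist (s • m) m + dist m (s • x) = dist (s • m) (s • x) := h
      linarith [dist_comm (s • m) m, dist_comm (s • x) (s • m)]
  rw [← hT.onGeod_smul s, smul_inv_smul]
  have hx' : OnGeod dist (s • x) (s • m) (s • s • m) := (hT.onGeod_smul s).2 hx
  have hlt : dist (s • x) m < dist (s • m) m + dist (s • m) (s • x) := by
    linarith [dist_comm (s • m) m, dist_comm (s • x) (s • m), dist_comm m (s • x)]
  exact hd.btw_symm (hd.btw_trans_right (hd.btw_symm hx') (by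
    rw [dist_comm (s • m) m] at hlt
    linarith [dist_comm (s • m) m]))

end IsOuterSpaceTree

/-! ### Geodesic lines in real trees -/

section Lines

variable {T : Type*} [MetricSpace T]

/-- A sequence converging at infinity, seen from `x`, defines a geodesic ray from `x`. -/
theorem IsRealTree.exists_ray (hT : IsRealTree T) (x : T) (Y : ℕ → T)
    (hY : ∀ R, ∃ n₀, ∀ n ≥ n₀, ∀ m ≥ n₀, R ≤ gromovProduct x (Y n) (Y m)) :
    ∃ ρ : ℝ → T, ∀ t, 0 ≤ t → dist x (ρ t) = t ∧ ∀ᶠ n in atTop, OnGeod dist x (ρ t) (Y n) := by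
  have hd := hT.isTreeDist
  have key : ∀ t : ℝ, ∃ z : T, 0 ≤ t →
      dist x z = t ∧ ∀ᶠ n in atTop, OnGeod dist x z (Y n) := by
    intro t
    by_cases ht : 0 ≤ t
    · obtain ⟨n₀, hn₀⟩ := hY t
      have h0 := hn₀ n₀ le_rfl n₀ le_rfl
      unfold gromovProduct at h0
      rw [dist_self] at h0
      obtain ⟨z, hz, e⟩ := hT.exists_onGeod x (Y n₀) ht (by linarith)
      refine ⟨z, fun _ => ⟨e, ?_⟩⟩
      filter_upwards [eventually_ge_atTop n₀] with n hn
      have h1 := hn₀ n₀ le_rfl n hn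
      unfold gromovProduct at h1
      have hz' : dist x z + dist z (Y n₀) = dist x (Y n₀) := hz
      refine hd.btw_symm (hd.btw_of_gromov (D := dist (Y n₀) z) (hd.btw_symm hz) ?_ le_rfl)
      linarith [dist_comm (Y n) (Y n₀), dist_comm (Y n₀) x, dist_comm (Y n) x,
        dist_comm (Y n₀) z]
    · exact ⟨x, fun h => absurd h ht⟩
  choose ρ hρ using key
  exact ⟨ρ, hρ⟩

/-- Two sequences converging at infinity and separated by `x` are joined by a line through `x`. -/
theorem IsRealTree.exists_line (hT : IsRealTree T) (x : T) (X Y : ℕ → T)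
    (hX : ∀ R, ∃ n₀, ∀ n ≥ n₀, ∀ m ≥ n₀, R ≤ gromovProduct x (X n) (X m))
    (hY : ∀ R, ∃ n₀, ∀ n ≥ n₀, ∀ m ≥ n₀, R ≤ gromovProduct x (Y n) (Y m))
    (hXY : ∀ᶠ n in atTop, OnGeod dist (X n) x (Y n)) :
    ∃ γ : ℝ → T, Isometry γ ∧ γ 0 = x ∧
      (∀ t, 0 ≤ t → ∀ᶠ n in atTop, OnGeod dist x (γ t) (Y n)) ∧
      (∀ t, 0 ≤ t → ∀ᶠ n in atTop, OnGeod dist x (γ (-t)) (X n)) := by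
  have hd := hT.isTreeDist
  obtain ⟨ρ₁, h₁⟩ := hT.exists_ray x X hX
  obtain ⟨ρ₂, h₂⟩ := hT.exists_ray x Y hY
  have same : ∀ (ρ : ℝ → T) (Z : ℕ → T), (∀ t, 0 ≤ t → dist x (ρ t) = t ∧
      ∀ᶠ n in atTop, OnGeod dist x (ρ t) (Z n)) → ∀ s t, 0 ≤ s → s ≤ t →
      dist (ρ s) (ρ t) = t - s := by
    intro ρ Z h s t hs hst
    have ht := hs.trans hst
    obtain ⟨n, hn, hn'⟩ := ((h s hs).2.and (h t ht).2).exists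
    obtain ⟨z, hz, e⟩ := hT.exists_onGeod x (ρ t) hs (by rwa [(h t ht).1])
    have hz' : OnGeod dist x z (Z n) := by
      refine hd.btw_of_le ?_
      have a1 := dist_triangle z (ρ t) (Z n)
      unfold OnGeod at hz hn'
      linarith
    have ez : z = ρ s := hd.eq_of_btw hz' hn (by rw [e, (h s hs).1])
    subst ez
    unfold OnGeod at hz
    rw [(h t ht).1, e] at hz
    linarith
  -- For large `n` both points lie on the geodesic from `X n` to `Y n`, on opposite sides of `x`.
  have opp : ∀ s t, 0 ≤ s → 0 ≤ t → dist (ρ₁ s) (ρ₂ t) = s + t := by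
    intro s t hs ht
    obtain ⟨n, ⟨hn, hn'⟩, hn''⟩ := (((h₁ s hs).2.and (h₂ t ht).2).and hXY).exists
    have a1 := dist_triangle (ρ₁ s) x (ρ₂ t)
    have a2 := dist_triangle4 (X n) (ρ₁ s) (ρ₂ t) (Y n)
    unfold OnGeod at hn hn' hn''
    have e1 := (h₁ s hs).1
    have e2 := (h₂ t ht).1
    linarith [dist_comm (ρ₁ s) x, dist_comm (X n) x, dist_comm (X n) (ρ₁ s)]
  let γ : ℝ → T := fun t => if 0 ≤ t then ρ₂ t else ρ₁ (-t)
  have ex₁ : ρ₁ 0 = x := (dist_eq_zero.1 (h₁ 0 le_rfl).1).symm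
  have ex₂ : ρ₂ 0 = x := (dist_eq_zero.1 (h₂ 0 le_rfl).1).symm
  have g₂ : ∀ t, 0 ≤ t → γ t = ρ₂ t := fun t ht => if_pos ht
  have g₁ : ∀ t, 0 ≤ t → γ (-t) = ρ₁ t := fun t ht => by
    rcases ht.eq_or_lt with rfl | ht
    · rw [neg_zero, g₂ 0 le_rfl, ex₁, ex₂]
    · change (if 0 ≤ -t then _ else _) = _
      rw [if_neg (by linarith), neg_neg]
  have hγ : ∀ s t, s ≤ t → dist (γ s) (γ t) = t - s := by
    intro s t hst
    rcases le_total 0 s with hs | hs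
    · rw [g₂ s hs, g₂ t (hs.trans hst), same ρ₂ Y h₂ s t hs hst]
    · rcases le_total 0 t with ht | ht
      · have := g₁ (-s) (by linarith)
        rw [neg_neg] at this
        rw [this, g₂ t ht, opp _ _ (by linarith) ht]
        ring
      · have e1 := g₁ (-s) (by linarith)
        have e2 := g₁ (-t) (by linarith)
        rw [neg_neg] at e1 e2
        rw [e1, e2, dist_comm, same ρ₁ X h₁ (-t) (-s) (by linarith) (by linarith)]
        ring
  refine ⟨γ, Isometry.of_dist_eq fun s t => ?_, ?_, fun t ht => ?_, fun t ht => ?_⟩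
  · rw [Real.dist_eq]
    rcases le_total s t with h | h
    · rw [hγ s t h, abs_of_nonpos (by linarith)]
      ring
    · rw [dist_comm, hγ t s h, abs_of_nonneg (by linarith)]
  · rw [g₂ 0 le_rfl, ex₂]
  · rw [g₂ t ht]
    exact (h₂ t ht).2
  · rw [g₁ t ht]
    exact (h₁ t ht).2

end Lines

/-! ### Comparison of cylinders -/

section Compare

variable {k : ℕ} {F : Type*} [Group F] {T : Type*} [MetricSpace T] [MulAction F T]

/-- The ray at time `t` lies on the way to some far `Y m`, and the Gromov products of `Y l` and `Y
m` are large; the four-point condition transfers this to `Y l` and `ρ t`. -/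
theorem endsAt_of_ray {b : FreeGroupBasis (Fin k) F} (hT : IsOuterSpaceTree F T) {o x : T}
    {Y : ℕ → T} {ξ : FreeBoundary k} {N : ℕ} (hYξ : ∀ n, Y n = boundaryPrefix b ξ (N + n) • o)
    (hY : ∀ R, ∃ n₀, ∀ n ≥ n₀, ∀ m ≥ n₀, R ≤ gromovProduct x (Y n) (Y m)) {ρ : ℝ → T}
    (h1 : ∀ t, 0 ≤ t → dist x (ρ t) = t)
    (h2 : ∀ t, 0 ≤ t → ∀ᶠ n in atTop, OnGeod dist x (ρ t) (Y n)) : EndsAt b ρ ξ := by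
  intro q
  rw [tendsto_atTop]
  intro R
  -- The two extra distances pay for changing the base point from `x` to `q` and the orbit from that
  -- of `o` to that of `q`.
  set R' := max 0 (R + dist x q + dist o q) with hR'
  obtain ⟨n₀, hn₀⟩ := hY R'
  have e1 : ∀ᶠ n : ℕ in atTop, N + n₀ ≤ n := eventually_ge_atTop _
  have e2 : ∀ᶠ t : ℝ in atTop, R' ≤ t := eventually_ge_atTop _
  filter_upwards [e1.prod_mk e2] with nt hnt
  obtain ⟨n, t⟩ := nt
  obtain ⟨hn, ht⟩ := hnt
  simp only at hn ht ⊢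
  have ht0 : 0 ≤ t := (le_max_left _ _).trans ht
  obtain ⟨l, rfl⟩ := Nat.exists_eq_add_of_le ((Nat.le_add_right N n₀).trans hn)
  obtain ⟨m, hm, hm'⟩ := ((h2 t ht0).and (eventually_ge_atTop n₀)).exists
  have a1 := hn₀ l (by omega) m hm'
  have a2 := hT.tree.four_point x (Y m) (Y l) (ρ t)
  have a3 := h1 t ht0
  have a4 : dist x (ρ t) + dist (ρ t) (Y m) = dist x (Y m) := hm
  have a5 : R' ≤ gromovProduct x (Y l) (ρ t) := by
    unfold gromovProduct at a1 ⊢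
    rcases le_max_iff.1 a2 with a2 | a2
    · linarith [dist_comm (Y m) (ρ t)]
    · linarith [dist_comm (Y m) (Y l)]
  rw [hYξ] at a5
  set g := boundaryPrefix b ξ (N + l)
  have b1 := dist_triangle4 x q (g • q) (g • o)
  have b2 := dist_triangle x q (ρ t)
  have b3 := dist_triangle (g • q) (g • o) (ρ t)
  rw [hT.dist_smul_smul] at b1 b3
  have b4 := le_max_right 0 (R + dist x q + dist o q)
  unfold gromovProduct at a5 ⊢
  linarith [dist_comm o q]

/-- Uniform control on the orbit map of the base point `o`: `A` bounds the length of the image of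
an edge, `N` measures properness and `D` is a bounded cancellation constant. -/
structure OrbitControl (b : FreeGroupBasis (Fin k) F) (o : T) (A D : ℝ) (N : ℝ → ℝ) : Prop where
  outer : IsOuterSpaceTree F T
  one_le_A : 1 ≤ A
  one_le_D : 1 ≤ D
  dist_letter_le : ∀ a, dist o (letterElt b a • o) ≤ A
  cdist_le : ∀ (R : ℝ) (x y : F), dist (x • o) (y • o) ≤ R → cdist b x y ≤ N R
  cancel : ∀ x y z : F, OnGeod (cdist b) x y z →
    dist (x • o) (y • o) + dist (y • o) (z • o) - dist (x • o) (z • o) ≤ 2 * D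

namespace IsOuterSpaceTree

theorem exists_orbitControl (b : FreeGroupBasis (Fin k) F) (hk : 2 ≤ k)
    (hT : IsOuterSpaceTree F T) (o : T) : ∃ A D N, OrbitControl b o A D N := by
  obtain ⟨A, hA1, hA⟩ := exists_dist_letterElt_le b o
  obtain ⟨N, hN⟩ := hT.exists_cdist_le b hk o
  obtain ⟨D, hD1, hD⟩ := hT.exists_bounded_cancellation b hk o
  exact ⟨A, D, N, hT, hA1, hD1, hA, hN, hD⟩

end IsOuterSpaceTree

namespace OrbitControl

variable {b : FreeGroupBasis (Fin k) F} {o : T} {A D : ℝ} {N : ℝ → ℝ}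

theorem dist_le (C : OrbitControl b o A D N) (x y : F) :
    dist (x • o) (y • o) ≤ A * cdist b x y :=
  C.outer.dist_orbit_le b C.dist_letter_le x y

/-- Properness sends `v n • o` far from `v 0 • o`, and bounded cancellation keeps Gromov products
based at `v 0 • o` within `D` of that distance. Changing the base point to `x` costs at most `dist x
(v 0 • o)`. -/
theorem converges (C : OrbitControl b o A D N) (x : T) {v : ℕ → F}
    (hv : ∀ n m : ℕ, cdist b (v n) (v m) = |(n : ℝ) - m|) (R : ℝ) :
    ∃ n₀, ∀ n ≥ n₀, ∀ m ≥ n₀, R ≤ gromovProduct x (v n • o) (v m • o) := by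
  set R' := R + D + dist x (v 0 • o)
  obtain ⟨n₀, hn₀⟩ := exists_nat_gt (N R')
  have far : ∀ n ≥ n₀, R' < dist (v 0 • o) (v n • o) := by
    intro n hn
    by_contra! h
    have h1 := C.cdist_le R' _ _ h
    rw [hv, Nat.cast_zero, zero_sub, abs_neg, Nat.abs_cast] at h1
    have : (n₀ : ℝ) ≤ n := by exact_mod_cast hn
    linarith
  have key : ∀ n ≥ n₀, ∀ m, n ≤ m → R ≤ gromovProduct x (v n • o) (v m • o) := by
    intro n hn m hnm
    have hnm' : (n : ℝ) ≤ m := by exact_mod_cast hnm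
    have hn0 : (0 : ℝ) ≤ n := n.cast_nonneg
    have h1 := C.cancel (v 0) (v n) (v m) (by
      unfold OnGeod
      rw [hv, hv, hv, Nat.cast_zero, abs_of_nonpos (by linarith), abs_of_nonpos (by linarith),
        abs_of_nonpos (by linarith)]
      ring)
    have h2 := far n hn
    have h3 := dist_triangle (v 0 • o) x (v n • o)
    have h4 := dist_triangle (v 0 • o) x (v m • o)
    unfold gromovProduct
    linarith [dist_comm (v 0 • o) x]
  refine ⟨n₀, fun n hn m hm => ?_⟩
  rcases le_total n m with h | h
  · exact key n hn m h
  · have := key m hm n h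
    unfold gromovProduct at *
    rw [dist_comm (v n • o)]
    linarith

/-- Lines through `g` and `h` contain the middle part of the image of `[g, h]`. -/
theorem cayleyCylinder_subset_cylinder (C : OrbitControl b o A D N) {g h : F} {x y : T}
    (hxy : dist (g • o) x + dist x y + dist y (h • o) = dist (g • o) (h • o))
    (hx : D ≤ dist (g • o) x) (hy : D ≤ dist y (h • o)) :
    cayleyCylinder b g h ⊆ cylinder b x y := by
  rintro q ⟨w, hw, i, j, hij, rfl, rfl⟩
  have hd := C.outer.tree.isTreeDist
  set X : ℕ → T := fun n => w (-n) • o with hX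
  set Y : ℕ → T := fun n => w n • o with hY
  set n₁ : ℕ := i.natAbs + j.natAbs
  have t1 := dist_triangle (w i • o) x (w j • o)
  have t2 := dist_triangle x y (w j • o)
  have t3 := dist_triangle (w i • o) x y
  have t4 := dist_triangle (w i • o) y (w j • o)
  -- Cancellation at `w i` and `w j` forces the segment from `X n` to `Y n` to follow the image of
  -- `[w i, w j]` outside the `D`-neighbourhoods of its ends, hence through `x` and then `y`.
  have order : ∀ n ≥ n₁, OnGeod dist (X n) x (Y n) ∧ OnGeod dist x y (Y n) := by
    intro n hn
    have c1 := C.cancel _ _ _ (hw.btw (i := -(n : ℤ)) (j := i) (l := j) (by omega) hij)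
    have c2 := C.cancel _ _ _ (hw.btw (i := -(n : ℤ)) (j := j) (l := n) (by omega) (by omega))
    have g1 : OnGeod dist (w i • o) x (w j • o) := hd.btw_of_le (by linarith)
    have g2 : OnGeod dist (w i • o) y (w j • o) := hd.btw_of_le (by linarith)
    have x1 : OnGeod dist (X n) x (w j • o) := hd.btw_of_gromov g1 c1 hx
    have y1 : OnGeod dist (X n) y (w j • o) :=
      hd.btw_of_gromov g2 c1 (by linarith [dist_nonneg (x := x) (y := y)])
    have c2' : dist (Y n) (w j • o) + dist (w j • o) (X n) - dist (Y n) (X n) ≤ 2 * D := by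
      rw [dist_comm (Y n), dist_comm (Y n), dist_comm _ (X n)]
      linarith
    have x2 : OnGeod dist (Y n) x (X n) := hd.btw_of_gromov (hd.btw_symm x1) c2' (by
      rw [dist_comm]
      linarith [dist_nonneg (x := x) (y := y)])
    have y2 : OnGeod dist (Y n) y (X n) := hd.btw_of_gromov (hd.btw_symm y1) c2' (by
      rwa [dist_comm])
    refine ⟨hd.btw_symm x2, hd.btw_of_le ?_⟩
    unfold OnGeod at x1 y1 x2 y2
    linarith [dist_comm (Y n) x, dist_comm (Y n) y, dist_comm (X n) x, dist_comm (X n) y]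
  have cX := fun R => C.converges x (v := fun n : ℕ => w (-n)) (fun n m => by
    rw [hw.1]
    push_cast
    rw [← abs_neg]
    congr 1
    ring) R
  have cY := fun R => C.converges x (v := fun n : ℕ => w n) (fun n m => by
    rw [hw.1]
    push_cast
    rfl) R
  obtain ⟨γ, hγ, γ0, γY, γX⟩ := C.outer.tree.exists_line x X Y cX cY
    ((eventually_ge_atTop n₁).mono fun n hn => (order n hn).1)
  obtain ⟨-, M, hM⟩ := hw
  have dγ : ∀ t, dist x (γ t) = |t| := fun t => by
    rw [← γ0, hγ.dist_eq, Real.dist_eq, zero_sub, abs_neg]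
  refine ⟨γ, hγ, ?_, ?_, 0, dist x y, dist_nonneg, γ0, ?_⟩
  · exact endsAt_of_ray C.outer (Y := X) (N := M) (fun n => by rw [hX]; simp only; rw [(hM n).1])
      cX (fun t ht => by rw [dγ, abs_neg, abs_of_nonneg ht]) γX
  · exact endsAt_of_ray C.outer (Y := Y) (N := M) (fun n => by rw [hY]; simp only; rw [(hM n).2])
      cY (fun t ht => by rw [dγ, abs_of_nonneg ht]) γY
  · obtain ⟨n, hn, hn'⟩ := ((γY (dist x y) dist_nonneg).and (eventually_ge_atTop n₁)).exists
    exact hd.eq_of_btw hn (order n hn').2 (by rw [dγ, abs_of_nonneg dist_nonneg])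

/-- A line of the tree through `x` and `y` is followed by a line of the Cayley tree. -/
theorem exists_near_of_mem_cylinder (C : OrbitControl b o A D N) (hk : 2 ≤ k) {x y : T}
    {q : DoubleBoundary k} (hq : q ∈ cylinder b x y) :
    ∃ w, IsCayleyLine b w q ∧ ∃ i j : ℤ, i ≤ j ∧ dist (w i • o) x ≤ A ∧
      dist (w j • o) y ≤ 2 * A := by
  have hd := C.outer.tree.isTreeDist
  have hA1 := C.one_le_A
  obtain ⟨w, hw⟩ := exists_isCayleyLine b q
  obtain ⟨γ, hγ, e1, e2, s, t, hst, rfl, rfl⟩ := hq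
  refine ⟨w, hw, ?_⟩
  have near : ∀ {i j : ℤ} {c : T}, i ≤ j → OnGeod dist (w i • o) c (w j • o) →
      ∃ m, i ≤ m ∧ m ≤ j ∧ dist (w m • o) c ≤ A := by
    intro i j c hij hc
    obtain ⟨f, a, hf, hf'⟩ := C.outer.exists_onGeod_letter b hk o hc
    obtain ⟨m, h1, h2, rfl⟩ := hw.exists_eq hij hf
    refine ⟨m, h1, h2, ?_⟩
    have h3 : dist (w m • o) c + dist c ((w m * letterElt b a) • o) = _ := hf'
    have h4 := C.dist_letter_le a
    rw [mul_smul, C.outer.dist_smul_smul] at h3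
    linarith [dist_nonneg (x := c) (y := w m • letterElt b a • o)]
  -- A Gromov product based at `o` exceeding `R` means that the line and the orbit of the word agree
  -- at infinity beyond both `γ s` and `γ t`; these two points therefore lie on the segment between
  -- far orbit points.
  set R := dist o (γ s) + dist o (γ t)
  have E1 := ((tendsto_atTop.1 (e1 o) (R + 1)))
  have E2 := ((tendsto_atTop.1 (e2 o) (R + 1)))
  rw [eventually_iff, mem_prod_iff] at E1 E2
  obtain ⟨U1, hU1, V1, hV1, h1⟩ := E1
  obtain ⟨U2, hU2, V2, hV2, h2⟩ := E2
  obtain ⟨M, hM⟩ := hw.2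
  have shift : Tendsto (fun n : ℕ => M + n) atTop atTop := tendsto_add_atTop_nat M |>.congr
    fun n => add_comm n M
  obtain ⟨n, hn1, hn2⟩ := ((shift.eventually hU1).and (shift.eventually hU2)).exists
  obtain ⟨τ, ⟨hτ1, hτ2⟩, hτ3, hτ4⟩ := ((Filter.Eventually.and hV1 hV2).and
    ((eventually_ge_atTop (-s)).and (eventually_ge_atTop t))).exists
  have g1 : R + 1 ≤ gromovProduct o (boundaryPrefix b q.fst (M + n) • o) (γ (-τ)) :=
    h1 (mk_mem_prod hn1 hτ1)
  have g2 : R + 1 ≤ gromovProduct o (boundaryPrefix b q.snd (M + n) • o) (γ τ) :=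
    h2 (mk_mem_prod hn2 hτ2)
  rw [← (hM n).1] at g1
  rw [← (hM n).2] at g2
  have line : ∀ {u v z : ℝ}, u ≤ v → v ≤ z → OnGeod dist (γ u) (γ v) (γ z) := by
    intro u v z huv hvz
    unfold OnGeod
    rw [hγ.dist_eq, hγ.dist_eq, hγ.dist_eq, Real.dist_eq, Real.dist_eq, Real.dist_eq,
      abs_of_nonpos (by linarith), abs_of_nonpos (by linarith), abs_of_nonpos (by linarith)]
    ring
  have base : ∀ {c u v : T}, dist o c ≤ R → R + 1 ≤ gromovProduct o u v →
      dist v u < dist c v + dist c u := by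
    intro c u v hc hg
    unfold gromovProduct at hg
    linarith [dist_triangle o c u, dist_triangle o c v, dist_comm u v]
  have hs : dist o (γ s) ≤ R := le_add_of_nonneg_right dist_nonneg
  have ht : dist o (γ t) ≤ R := le_add_of_nonneg_left dist_nonneg
  have a1 : OnGeod dist (γ (-τ)) (γ s) (w n • o) :=
    hd.btw_trans_right (line (by linarith) (by linarith)) (base hs g2)
  have a2 : OnGeod dist (w (-n) • o) (γ s) (w n • o) :=
    hd.btw_symm (hd.btw_trans_right (hd.btw_symm a1) (base hs g1))
  have a3 : OnGeod dist (γ s) (γ t) (w n • o) :=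
    hd.btw_trans_right (line hst (by linarith)) (base ht g2)
  obtain ⟨i, hi1, hi2, hi⟩ := near (by omega) a2
  -- A short segment allows `j = i`, which accounts for the bound `2 * A`. For a long one, `w i • o`
  -- is too close to `γ s` to be past `γ t`, so `j` can be found after `i`.
  by_cases hlt : dist (γ s) (γ t) ≤ A
  · exact ⟨i, i, le_rfl, hi, by linarith [dist_triangle (w i • o) (γ s) (γ t)]⟩
  · have a4 : OnGeod dist (w i • o) (γ t) (w n • o) := by
      refine hd.btw_symm (hd.btw_trans_right (hd.btw_symm a3) ?_)
      have := dist_nonneg (x := γ t) (y := w i • o)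
      linarith [dist_comm (γ s) (γ t), dist_comm (γ s) (w i • o)]
    obtain ⟨j, hj1, hj2, hj⟩ := near hi2 a4
    exact ⟨i, j, hj1, hi, by linarith⟩

end OrbitControl

end Compare

/-! ### Transfer of tameness between `T` and the Cayley tree. -/

section Tameness

variable {k : ℕ} {F : Type*} [Group F] {b : FreeGroupBasis (Fin k) F}

/-- The predicate `P` discards the indices for which no bound is available; counting all of `s`
nevertheless keeps the constant the same for all segments. -/
theorem MeasureTheory.measure_le_card_mul_of_cover {Ω ι : Type*} [MeasurableSpace Ω]
    (m : Measure Ω) {S : Set Ω} (s : Finset ι) (P : ι → Prop) (f : ι → Set Ω) {c : ℝ≥0∞}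
    (hS : ∀ q ∈ S, ∃ i ∈ s, P i ∧ q ∈ f i) (hf : ∀ i, P i → m (f i) ≤ c) :
    m S ≤ s.card * c := by
  classical
  have h1 : S ⊆ ⋃ i ∈ s.filter P, f i := fun q hq => by
    obtain ⟨i, hi, hP, hqi⟩ := hS q hq
    exact mem_biUnion (Finset.mem_filter.2 ⟨hi, hP⟩) hqi
  calc m S ≤ ∑ i ∈ s.filter P, m (f i) := (measure_mono h1).trans (measure_biUnion_finset_le _ _)
    _ ≤ (s.filter P).card • c :=
      Finset.sum_le_card_nsmul _ _ _ fun i hi => hf i (Finset.mem_filter.1 hi).2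
    _ ≤ s.card * c := by
      rw [nsmul_eq_mul]
      gcongr
      exact Finset.filter_subset _ _

/-- Tameness with respect to the Cayley tree. -/
def IsCayleyTame (μ : GeodesicCurrent b) : Prop :=
  ∀ r : ℝ, ∃ C : ℝ≥0, ∀ g₁ h₁ g₂ h₂ : F, cdist b g₁ g₂ ≤ r → cdist b h₁ h₂ ≤ r → g₁ ≠ h₁ →
    g₂ ≠ h₂ → μ.toMeasure (cayleyCylinder b g₁ h₁) ≤ C * μ.toMeasure (cayleyCylinder b g₂ h₂)

/-- The product of two balls around `1` in the word metric. -/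
noncomputable def ballProd (b : FreeGroupBasis (Fin k) F) (r : ℝ) : Finset (F × F) :=
  (finite_cdist_le b 1 r).toFinset ×ˢ (finite_cdist_le b 1 r).toFinset

theorem exists_mem_ballProd {r : ℝ} {g h g' h' : F} (hg : cdist b g g' ≤ r)
    (hh : cdist b h h' ≤ r) : ∃ u ∈ ballProd b r, g' = g * u.1 ∧ h' = h * u.2 := by
  refine ⟨(g⁻¹ * g', h⁻¹ * h'), ?_, by simp, by simp⟩
  simp only [ballProd, Finset.mem_product, Finite.mem_toFinset, mem_ofPred_eq]
  constructor
  · rwa [← cdist_mul_left b g, mul_one, mul_inv_cancel_left]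
  · rwa [← cdist_mul_left b h, mul_one, mul_inv_cancel_left]

namespace OrbitControl

variable {T : Type*} [MetricSpace T] [MulAction F T] {o : T} {A D : ℝ} {N : ℝ → ℝ}

/-- The points `x`, `y` are the images of the ends of `[g, h]` prolonged by `L` on both sides. A
Cayley line following a line of `T` through them passes within less than `L` of the prolonged ends,
hence must traverse `[g, h]`. -/
theorem exists_cylinder_subset_cayleyCylinder (C : OrbitControl b o A D N) (hk : 2 ≤ k) {L : ℕ}
    (hL : N A < L) (hL' : N (2 * A) < L) {g h : F} :
    ∃ x y : T, x ≠ y ∧ dist (g • o) x ≤ A * L ∧ dist (h • o) y ≤ A * L ∧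
      cylinder b x y ⊆ cayleyCylinder b g h := by
  have hC := isTreeDist_cdist b
  have hL0 : (0 : ℝ) < L := by
    refine lt_of_le_of_lt ?_ hL
    refine (hC.nonneg 1 1).trans (C.cdist_le A 1 1 ?_)
    rw [dist_self]
    linarith [C.one_le_A]
  obtain ⟨g', hg', hgb⟩ := exists_extension b hk g h L
  obtain ⟨h', hh', hhb⟩ := exists_extension b hk h g' L
  have b1 : OnGeod (cdist b) g' h h' := hC.btw_symm hhb
  have b2 : OnGeod (cdist b) g' g h' := by
    refine hC.btw_of_le ?_
    have := hC.triangle g h h'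
    unfold OnGeod at b1 hgb
    linarith
  refine ⟨g' • o, h' • o, ?_, ?_, ?_, ?_⟩
  · intro e
    have e1 : g' = h' := by
      rw [eq_comm, ← inv_smul_eq_iff, ← mul_smul] at e
      exact (inv_mul_eq_one.1 (C.outer.free _ _ e))
    subst e1
    unfold OnGeod at b2
    rw [hC.self] at b2
    linarith [hC.nonneg g g']
  · refine (C.dist_le _ _).trans ?_
    rw [hC.symm, hg']
  · refine (C.dist_le _ _).trans ?_
    rw [hC.symm, hh']
  · intro q hq
    obtain ⟨w, hw, i, j, hij, hi, hj⟩ := C.exists_near_of_mem_cylinder hk hq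
    have h1 := C.cdist_le _ _ _ hi
    have h2 := C.cdist_le _ _ _ hj
    refine mem_cayleyCylinder_of_near b hw hij hgb b2 b1 ?_ ?_
    · linarith
    · rw [hC.symm h h']
      linarith

/-- Lines through `[g₁, h₁]` are sorted by their prolongations of length `L` at both ends. Each
prolonged Cayley cylinder lies in a trimmed tree cylinder, which tameness compares with a tree
cylinder inside that of `[g₂, h₂]`. -/
theorem isCayleyTame (C : OrbitControl b o A D N) (hk : 2 ≤ k) {μ : GeodesicCurrent b}
    (hμ : IsTame μ T) : IsCayleyTame μ := by
  have hC := isTreeDist_cdist b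
  have hA := C.one_le_A
  have hD := C.one_le_D
  intro r
  by_cases hr : 0 ≤ r
  swap
  · exact ⟨0, fun g₁ _ g₂ _ h => absurd ((hC.nonneg g₁ g₂).trans h) hr⟩
  -- The first two bounds serve the inclusion around `[g₂, h₂]`; `L > N (2 * D)` makes the prolonged
  -- images longer than `2 * D`, so that trimming leaves distinct endpoints.
  obtain ⟨L, hL⟩ := exists_nat_gt (max (max (N A) (N (2 * A))) (N (2 * D)))
  simp only [max_lt_iff] at hL
  obtain ⟨⟨hL1, hL2⟩, hL3⟩ := hL
  have hL0 : (0 : ℝ) ≤ L := L.cast_nonneg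
  have hAL : 0 ≤ A * L := by positivity
  have hAr : 0 ≤ A * r := by positivity
  -- The summands are the legs of the route from `x` to `x₂`: trimming, prolongation of `[g₁, h₁]`,
  -- passage from `g₁` to `g₂`, prolongation of `[g₂, h₂]`.
  obtain ⟨K, -, hK⟩ := hμ (D + A * L + A * r + A * L) (by linarith)
  refine ⟨(ballProd b L).card * K, fun g₁ h₁ g₂ h₂ hg hh _ _ => ?_⟩
  obtain ⟨x₂, y₂, hne₂, hx₂, hy₂, hsub₂⟩ :=
    C.exists_cylinder_subset_cayleyCylinder hk hL1 hL2 (g := g₂) (h := h₂)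
  rw [ENNReal.coe_mul, ENNReal.coe_natCast, mul_assoc]
  refine measure_le_card_mul_of_cover _ (ballProd b L)
    (fun u => cdist b g₁ (g₁ * u.1) ≤ L ∧ cdist b h₁ (h₁ * u.2) ≤ L ∧
      2 * D < dist ((g₁ * u.1) • o) ((h₁ * u.2) • o))
    (fun u => cayleyCylinder b (g₁ * u.1) (h₁ * u.2)) ?_ ?_
  · rintro q ⟨w, hw, i, j, hij, rfl, rfl⟩
    have d1 : cdist b (w i) (w (i - L)) = L := by
      rw [hC.symm, hw.cdist_of_le (by omega)]
      push_cast
      ring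
    have d2 : cdist b (w j) (w (j + L)) = L := by
      rw [hw.cdist_of_le (by omega)]
      push_cast
      ring
    have d3 : 2 * D < dist (w (i - L) • o) (w (j + L) • o) := by
      by_contra! hcon
      have h1 := C.cdist_le _ _ _ hcon
      rw [hw.cdist_of_le (by omega)] at h1
      push_cast at h1
      have : (i : ℝ) ≤ j := by exact_mod_cast hij
      linarith
    obtain ⟨u, hu, e1, e2⟩ := exists_mem_ballProd d1.le d2.le
    refine ⟨u, hu, ?_, ?_⟩
    · rw [← e1, ← e2]
      exact ⟨d1.le, d2.le, d3⟩
    · rw [← e1, ← e2]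
      exact ⟨w, hw, i - L, j + L, by omega, rfl, rfl⟩
  · rintro ⟨u, v⟩ ⟨hu, hv, hd⟩
    simp only at hu hv hd ⊢
    obtain ⟨x, hx, ex⟩ := C.outer.tree.exists_onGeod ((g₁ * u) • o) ((h₁ * v) • o) (r := D)
      (by linarith) (by linarith)
    unfold OnGeod at hx
    obtain ⟨y, hy, ey⟩ := C.outer.tree.exists_onGeod x ((h₁ * v) • o)
      (r := dist ((g₁ * u) • o) ((h₁ * v) • o) - 2 * D) (by linarith) (by linarith)
    unfold OnGeod at hy
    have hne : x ≠ y := by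
      rw [← dist_pos]
      linarith
    refine (measure_mono (C.cayleyCylinder_subset_cylinder (x := x) (y := y) (by linarith)
      ex.ge (by linarith))).trans ((hK x y x₂ y₂ ?_ ?_ hne hne₂).2.trans ?_)
    · have t1 := dist_triangle4 x ((g₁ * u) • o) (g₁ • o) (g₂ • o)
      have t2 := dist_triangle x (g₂ • o) x₂
      have t3 := C.dist_le g₁ (g₁ * u)
      have t4 := C.dist_le g₁ g₂
      have t5 := mul_le_mul_of_nonneg_left hu (zero_le_one.trans hA)
      have t6 := mul_le_mul_of_nonneg_left hg (zero_le_one.trans hA)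
      linarith [dist_comm x ((g₁ * u) • o), dist_comm ((g₁ * u) • o) (g₁ • o)]
    · have t1 := dist_triangle4 y ((h₁ * v) • o) (h₁ • o) (h₂ • o)
      have t2 := dist_triangle y (h₂ • o) y₂
      have t3 := C.dist_le h₁ (h₁ * v)
      have t4 := C.dist_le h₁ h₂
      have t5 := mul_le_mul_of_nonneg_left hv (zero_le_one.trans hA)
      have t6 := mul_le_mul_of_nonneg_left hh (zero_le_one.trans hA)
      linarith [dist_comm ((h₁ * v) • o) (h₁ • o)]
    · gcongr

/-- Segments can be extended backwards, by a bounded amount, to start in the orbit of a point on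
an axis. -/
theorem exists_orbit_behind (C : OrbitControl b o A D N) (hk : 2 ≤ k) {s : F} (hs : s ≠ 1)
    (haxis : OnGeod dist (s⁻¹ • o) o (s • o)) :
    ∃ E : ℝ, ∀ x y : T, ∃ g : F, OnGeod dist (g • o) x y ∧ D ≤ dist (g • o) x ∧
      dist (g • o) x ≤ E := by
  have hT := C.outer
  have hd := hT.tree.isTreeDist
  set l := dist o (s • o) with hl
  have hl0 : 0 < l := dist_pos.2 fun e => hs (hT.free s o e.symm)
  set n := ⌈D / l⌉₊
  have hn : D ≤ n * l := by
    rw [← div_le_iff₀ hl0]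
    exact Nat.le_ceil _
  refine ⟨n * l + A, fun x y => ?_⟩
  -- Of the two ends of a translated edge containing `x`, one has `x` between it and `y`.
  obtain ⟨f, hf, hfx⟩ : ∃ f : F, OnGeod dist (f • o) x y ∧ dist (f • o) x ≤ A := by
    obtain ⟨f, a, hf⟩ := hT.exists_near b hk o x
    have h1 : dist (f • o) x + dist x ((f * letterElt b a) • o) = _ := hf
    have h2 := C.dist_letter_le a
    have h3 : dist (f • o) ((f * letterElt b a) • o) = dist o (letterElt b a • o) := by
      rw [mul_smul, hT.dist_smul_smul]
    rcases hd.btw_or_btw hf y with h | h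
    · exact ⟨f, h, by linarith [dist_nonneg (x := x) (y := (f * letterElt b a) • o)]⟩
    · refine ⟨f * letterElt b a, hd.btw_symm h, ?_⟩
      rw [dist_comm]
      linarith [dist_nonneg (x := f • o) (y := x)]
  -- The axis of the conjugate `g * s * g⁻¹` passes through `g • o`, and at least one of its two
  -- directions leads away from `y`; each step gains `l`.
  have key : ∀ n : ℕ, ∃ g : F, OnGeod dist (g • o) (f • o) y ∧
      dist (g • o) (f • o) = n * l := by
    intro n
    induction n with
    | zero => exact ⟨f, hd.btw_left _ _, by simp⟩
    | succ n ih =>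
      obtain ⟨g, hg, e⟩ := ih
      have h1 : OnGeod dist ((g * s⁻¹) • o) (g • o) ((g * s) • o) := by
        rw [mul_smul, mul_smul]
        exact (hT.onGeod_smul g).2 haxis
      obtain ⟨g', hg', e'⟩ : ∃ g' : F, OnGeod dist (g' • o) (g • o) y ∧
          dist (g' • o) (g • o) = l := by
        rcases hd.btw_or_btw h1 y with h | h
        · refine ⟨_, h, ?_⟩
          rw [mul_smul, hT.dist_smul_smul, hT.dist_smul_left, inv_inv]
        · refine ⟨_, hd.btw_symm h, ?_⟩
          rw [mul_smul, hT.dist_smul_smul, dist_comm]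
      have t1 := dist_triangle (g' • o) (g • o) (f • o)
      have t2 := dist_triangle (g' • o) (f • o) y
      unfold OnGeod at *
      refine ⟨g', ?_, ?_⟩
      · linarith
      · push_cast
        linarith
  obtain ⟨g, hg, e⟩ := key n
  have t1 := dist_triangle (g • o) (f • o) x
  have t2 := dist_triangle (g • o) x y
  unfold OnGeod at *
  refine ⟨g, ?_, ?_, ?_⟩
  · linarith
  · linarith [dist_nonneg (x := f • o) (y := x)]
  · linarith

/-- The tree cylinder of `[a₂, b₂]` contains the Cayley cylinder of orbit points found at bounded
distance behind both ends, while that of `[a₁, b₁]` is covered by Cayley cylinders whose endpoints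
have images near `a₁` and `b₁`. -/
theorem isTame (C : OrbitControl b o A D N) (hk : 2 ≤ k) {s : F} (hs : s ≠ 1)
    (haxis : OnGeod dist (s⁻¹ • o) o (s • o)) {μ : GeodesicCurrent b}
    (hμ : IsCayleyTame μ) : IsTame μ T := by
  have hT := C.outer
  have hd := hT.tree.isTreeDist
  have hA := C.one_le_A
  obtain ⟨E, hE⟩ := C.exists_orbit_behind hk hs haxis
  intro M hM
  obtain ⟨K, hK⟩ := hμ (max (N (A + M + E)) (N (3 * A + M + E)))
  -- The reference point `f • o` and `w i • o` are both within `A` of `a₁`; near `b₁` the two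
  -- distances are `A` and `3 * A`.
  set r := max (N (2 * A)) (N (4 * A))
  have main : ∀ a₁ b₁ a₂ b₂ : T, dist a₁ a₂ ≤ M → dist b₁ b₂ ≤ M → a₂ ≠ b₂ →
      μ.toMeasure (cylinder b a₁ b₁) ≤
        ((ballProd b r).card * K : ℝ≥0) * μ.toMeasure (cylinder b a₂ b₂) := by
    intro a₁ b₁ a₂ b₂ ha hb hne
    obtain ⟨g, hg, hgD, hgE⟩ := hE a₂ b₂
    obtain ⟨h, hh, hhD, hhE⟩ := hE b₂ a₂
    have hpos := dist_pos.2 hne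
    have e1 := hd.add_eq_of_btw hg (hd.btw_symm hh) hpos
    have hgh : g ≠ h := by
      rintro rfl
      rw [dist_self] at e1
      linarith [dist_nonneg (x := g • o) (y := a₂), dist_nonneg (x := b₂) (y := g • o)]
    have hsub := C.cayleyCylinder_subset_cylinder e1 hgD (by rwa [dist_comm])
    obtain ⟨f, a, hf⟩ := hT.exists_near b hk o a₁
    obtain ⟨f', a', hf'⟩ := hT.exists_near b hk o b₁
    have near : ∀ {f : F} {a : Fin k × Bool} {x : T},
        OnGeod dist (f • o) x ((f * letterElt b a) • o) → dist (f • o) x ≤ A := by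
      intro f a x h
      have h3 : dist (f • o) x + dist x ((f * letterElt b a) • o) = _ := h
      have h4 := C.dist_letter_le a
      rw [mul_smul, hT.dist_smul_smul] at h3
      linarith [dist_nonneg (x := x) (y := f • letterElt b a • o)]
    have hf := near hf
    have hf' := near hf'
    rw [ENNReal.coe_mul, ENNReal.coe_natCast, mul_assoc]
    refine measure_le_card_mul_of_cover _ (ballProd b r)
      (fun u => dist ((f * u.1) • o) a₁ ≤ A ∧ dist ((f' * u.2) • o) b₁ ≤ 3 * A ∧
        f * u.1 ≠ f' * u.2)
      (fun u => cayleyCylinder b (f * u.1) (f' * u.2)) ?_ ?_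
    · intro q hq
      obtain ⟨w, hw, i, j, hij, hi, hj⟩ := C.exists_near_of_mem_cylinder hk hq
      have hij' : (i : ℝ) ≤ j := by exact_mod_cast hij
      -- Since `i = j` may occur and `IsCayleyTame` compares segments with distinct ends, the
      -- segment is lengthened by one edge, at a cost of `A`.
      have hj' : dist (w (j + 1) • o) b₁ ≤ 3 * A := by
        have t1 := C.dist_le (w j) (w (j + 1))
        rw [hw.cdist_of_le (by omega)] at t1
        push_cast at t1
        have t2 := dist_triangle (w (j + 1) • o) (w j • o) b₁
        rw [dist_comm (w (j + 1) • o) (w j • o)] at t2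
        linarith
      have hne' : w i ≠ w (j + 1) := by
        intro e
        have h1 := hw.cdist_of_le (i := i) (j := j + 1) (by omega)
        rw [e, (isTreeDist_cdist b).self] at h1
        push_cast at h1
        linarith
      obtain ⟨u, hu, e1, e2⟩ := exists_mem_ballProd (b := b) (r := r) (g := f) (g' := w i)
        (h := f') (h' := w (j + 1))
        ((C.cdist_le (2 * A) _ _ (by linarith [dist_triangle_right (f • o) (w i • o) a₁])).trans
          (le_max_left _ _))
        ((C.cdist_le (4 * A) _ _
          (by linarith [dist_triangle_right (f' • o) (w (j + 1) • o) b₁])).trans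
          (le_max_right _ _))
      refine ⟨u, hu, ?_, ?_⟩
      · rw [← e1, ← e2]
        exact ⟨hi, hj', hne'⟩
      · rw [← e1, ← e2]
        exact ⟨w, hw, i, j + 1, by omega, rfl, rfl⟩
    · rintro ⟨u, v⟩ ⟨hu, hv, huv⟩
      simp only at hu hv huv ⊢
      refine (hK (f * u) (f' * v) g h ?_ ?_ huv hgh).trans ?_
      · refine (C.cdist_le (A + M + E) _ _ ?_).trans (le_max_left _ _)
        linarith [dist_triangle4 ((f * u) • o) a₁ a₂ (g • o), dist_comm a₂ (g • o)]
      · refine (C.cdist_le (3 * A + M + E) _ _ ?_).trans (le_max_right _ _)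
        linarith [dist_triangle4 ((f' * v) • o) b₁ b₂ (h • o), dist_comm b₂ (h • o)]
      · gcongr
  set K' : ℝ≥0 := (ballProd b r).card * K
  refine ⟨max 1 K', le_max_left _ _, fun a₁ b₁ a₂ b₂ ha hb h1 h2 => ⟨?_, ?_⟩⟩
  · have := main a₂ b₂ a₁ b₁ (by rwa [dist_comm]) (by rwa [dist_comm]) h1
    rw [one_div, ← ENNReal.div_eq_inv_mul]
    refine ENNReal.div_le_of_le_mul' (this.trans ?_)
    gcongr
    exact le_max_right _ _
  · refine (main a₁ b₁ a₂ b₂ ha hb h2).trans ?_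
    gcongr
    exact le_max_right _ _

end OrbitControl

theorem isTame_iff_isCayleyTame (hk : 2 ≤ k) (μ : GeodesicCurrent b) {T : Type*} [MetricSpace T]
    [MulAction F T] (hT : IsOuterSpaceTree F T) : IsTame μ T ↔ IsCayleyTame μ := by
  obtain ⟨o, s, hs, haxis⟩ := hT.exists_axis b hk
  obtain ⟨A, D, N, C⟩ := hT.exists_orbitControl b hk o
  exact ⟨C.isCayleyTame hk, C.isTame hk hs haxis⟩

end Tameness

theorem mainTheorem9 {k : ℕ} (hk : 2 ≤ k) {F : Type*} [Group F] (b : FreeGroupBasis (Fin k) F)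
    (μ : GeodesicCurrent b)
    {T : Type*} [MetricSpace T] [MulAction F T] (hT : IsOuterSpaceTree F T)
    {T' : Type*} [MetricSpace T'] [MulAction F T'] (hT' : IsOuterSpaceTree F T') :
    IsTame μ T ↔ IsTame μ T' := by
  rw [isTame_iff_isCayleyTame hk μ hT, isTame_iff_isCayleyTame hk μ hT']
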